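/- Let $r\ge 1$ and $1\le n\le \ell$ be integers. **Automata.** The expert automaton $\mathscr A$ has states $0,\dots,\ell$, initial state $0$, final state $\ell$, and, for each $1\le i\le \ell$, $r$ parallel transitions $h_{1,i},\dots,h_{r,i}$ from $i-1$ to $i$; its accepting paths are the path experts, and $\mathscr P$ is their set. The context-dependent automaton $\mathscr A'$ has one transition $e'=\#h_{j_1,i+1}\cdots h_{j_n,i+n}$ for every $0\le i\le \ell-n$ and $j_1,\dots,j_n\in\{1,\dots,r\}$. Its states are an initial state (layer $0$) and, in each layer $1,\dots,\ell-n+1$, one state for each word in $\{1,\dots,r\}^{n-1}$. The transition above goes from layer $i$ to layer $i+1$; it leaves the state $j_1\cdots j_{n-1}$ (the initial state if $i=0$) and enters the state $j_2\cdots j_n$. The states of layer $\ell-n+1$ are final. An accepting path $\pi$ of $\mathscr A$ corresponds to the accepting path $\pi'$ of $\mathscr A'$ whose transitions are the successive $n$-grams of $\pi$. **Game.** Let $\Theta$ be a finite set of words of length $n$ over an alphabet $\Sigma$, and let $|x|_\theta$ be the number of occurrences of $\theta$ as a contiguous factor of $x$. In round $t=1,\dots,T$ an adversary fixes a symbol $\mathrm{out}_t(e)\in\Sigma$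 for each transition $e$ of $\mathscr A$ and a target sequence $y_t\in\Sigma^*$ (possibly depending on the paths that the learner sampled in earlier rounds). The learner chooses $\pi_t\in\mathscr P$. The gain of $\pi\in\mathscr P$ is $\mathscr U(\mathrm{out}_t(\pi),y_t)=\sum_{\theta\in\Theta}|\mathrm{out}_t(\pi)|_\theta\,|y_t|_\theta$, where $\mathrm{out}_t$ of a path or of an $n$-gram is the concatenation of the outputs. The gain $g_{t,e'}$ of a transition $e'$ of $\mathscr A'$ is $|y_t|_{\mathrm{out}_t(e')}$ if $\mathrm{out}_t(e')\in\Theta$, and $0$ otherwise. Suppose that $g_{t,e'}\le B$ for all $t\le T$ and all $e'$. **CDSB** with parameters $\eta,\beta>0$, $\gamma\in(0,1)$ and a set $C$ of covering paths (accepting paths of $\mathscr A'$ that contain all its transitions). It keeps transition weights $w_t$ such that $p_t(\pi')=\prod_{e'\in\pi'}w_t(e')$ is a probability distribution on the accepting paths of $\mathscr A'$; $p_1$ is uniform. In round $t$ it samples $\pi'_t$ from $(1-\gamma)p_t+\gamma\mu$, with $\mu$ uniform on $C$, plays the corresponding $\pi_t\in\mathscr P$, and observes $g_{t,e'}$ for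 $e'\in\pi'_t$. Let $q_{t,e'}$ be the probability that the sampled path contains $e'$. Put $\widetilde g_{t,e'}=(g_{t,e'}+\beta)/q_{t,e'}$ if $e'\in\pi'_t$ and $\widetilde g_{t,e'}=\beta/q_{t,e'}$ otherwise, and $\widehat w_t(e')=w_t(e')\exp(\eta\,\widetilde g_{t,e'})$. The weights $w_{t+1}$ result from $\widehat w_t$ by weight pushing: $w_{t+1}(e')=d[q]^{-1}\,\widehat w_t(e')\,d[q']$ for $e'$ from $q$ to $q'$, where $d[q]$ is the sum over all paths from $q$ to a final state of the products of their weights $\widehat w_t$. Hence $p_{t+1}(\pi')\propto\prod_{e'\in\pi'}\widehat w_t(e')$. **Claim.** 1. There is a set $C$ of $r^n$ accepting paths of $\mathscr A'$, each with $\ell-n+1$ transitions, such that every transition of $\mathscr A'$ lies on exactly one path of $C$. 2. For all $T\in\mathbb N$, $B\in\mathbb R$ and $\delta\in(0,1)$ there are parameters $\eta,\beta>0$ and $\gamma\in(0,1)$, depending only on $r,\ell,n,T,B,\delta$, such that for every set $C$ of $r^n$ paths as in 1, every $\Sigma$ and $\Theta$, and every adversary for which the gains of the transitions of $\mathscr A'$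 in rounds $1,\dots,T$ are at most $B$, the following holds with probability at least $1-\delta$: for all $\pi^*\in\mathscr P$, $$\sum_{t=1}^T\Big(\mathscr U(\mathrm{out}_t(\pi^*),y_t)-\mathscr U(\mathrm{out}_t(\pi_t),y_t)\Big)\le 2B(\ell-n+1)\sqrt T\left(\sqrt{4\,r^n\,\ell\,\ln r}+\sqrt{r^n\ln\frac{r^n(\ell-n+1)}{\delta}}\right).$$ -/

import Mathlib

noncomputable section

/-! ## Acyclic automata, accepting paths, weight pushing -/

/-- A finite acyclic automaton with states `Q`, (uniquely named) transitions `E`, one initial state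
and a set of final states. Final states have no outgoing transition, so that transition weights
whose outflow is one at every non-final state define a distribution on accepting paths. -/
structure PathAutomaton (Q E : Type*) where
  src : E → Q
  tgt : E → Q
  init : Q
  final : Set Q
  acyclic : ∀ q, ¬ Relation.TransGen (fun a b => ∃ e, src e = a ∧ tgt e = b) q q
  final_sink : ∀ e, src e ∉ final

namespace PathAutomaton

variable {Q E : Type*} (A : PathAutomaton Q E)

/-- The list of transitions `l` is a path from the state `q` to some final state. -/
def IsPathToFinal : Q → List E → Prop
  | q, [] => q ∈ A.final
  | q, e :: l => A.src e = q ∧ IsPathToFinal (A.tgt e) l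

/-- The set of paths from `q` to final states. -/
abbrev PathsFrom (q : Q) := {l : List E // A.IsPathToFinal q l}

/-- Accepting paths. -/
abbrev Path := A.PathsFrom A.init

theorem reach_of_mem : ∀ (l : List E) (q : Q), A.IsPathToFinal q l → ∀ e ∈ l,
    Relation.ReflTransGen (fun a b => ∃ e, A.src e = a ∧ A.tgt e = b) q (A.src e)
  | [], _, _, _, he => by simp at he
  | a :: l, q, h, e, he => by
    obtain ⟨h1, h2⟩ := h
    rcases List.mem_cons.1 he with rfl | he
    · rw [h1]
    · exact Relation.ReflTransGen.head ⟨a, h1, rfl⟩ (reach_of_mem l _ h2 e he)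

theorem nodup_of_isPathToFinal : ∀ (l : List E) (q : Q), A.IsPathToFinal q l → l.Nodup
  | [], _, _ => List.nodup_nil
  | a :: l, _, h => by
    refine List.nodup_cons.2 ⟨fun ha => ?_, nodup_of_isPathToFinal l _ h.2⟩
    exact A.acyclic (A.src a)
      (Relation.TransGen.head' ⟨a, rfl, rfl⟩ (A.reach_of_mem l _ h.2 a ha))

instance finite_pathsFrom [Finite E] (q : Q) : Finite (A.PathsFrom q) := by
  classical
  have := Fintype.ofFinite E
  exact Finite.of_injective
    (fun π : A.PathsFrom q => (⟨π.1, A.nodup_of_isPathToFinal _ _ π.2⟩ : {l : List E // l.Nodup}))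
    (fun a b h => Subtype.ext (congrArg (fun x => x.1) h))

instance fintype_pathsFrom [Finite E] (q : Q) : Fintype (A.PathsFrom q) := Fintype.ofFinite _

/-- The weight of a path: the product of the weights of its transitions. -/
def pathWeight (w : E → ℝ) (l : List E) : ℝ := (l.map w).prod

theorem pathWeight_nonneg {w : E → ℝ} (hw : ∀ e, 0 ≤ w e) (l : List E) : 0 ≤ pathWeight w l :=
  List.prod_nonneg (by simpa using fun e _ => hw e)

variable [Finite E]

/-- `d[q]`: the sum of the weights of all paths from `q` to final states. -/
def pathSum (w : E → ℝ) (q : Q) : ℝ := ∑ π : A.PathsFrom q, pathWeight w π.1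

open Classical in
/-- Weight pushing: `w(e) ← d[src e]⁻¹ w(e) d[tgt e]` wherever `d[src e] ≠ 0`. -/
def push (w : E → ℝ) (e : E) : ℝ :=
  if A.pathSum w (A.src e) = 0 then w e
  else (A.pathSum w (A.src e))⁻¹ * w e * A.pathSum w (A.tgt e)

theorem pathSum_nonneg {w : E → ℝ} (hw : ∀ e, 0 ≤ w e) (q : Q) : 0 ≤ A.pathSum w q :=
  Finset.sum_nonneg fun _ _ => pathWeight_nonneg hw _

theorem push_nonneg {w : E → ℝ} (hw : ∀ e, 0 ≤ w e) (e : E) : 0 ≤ A.push w e := by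
  unfold push
  split_ifs
  · exact hw e
  · exact mul_nonneg (mul_nonneg (inv_nonneg.2 (A.pathSum_nonneg hw _)) (hw e))
      (A.pathSum_nonneg hw _)

theorem pathSum_final (w : E → ℝ) {q : Q} (hq : q ∈ A.final) : A.pathSum w q = 1 := by
  have h : ∀ π : A.PathsFrom q, π = ⟨[], hq⟩ := by
    rintro ⟨_ | ⟨e, l⟩, h⟩
    · rfl
    · exact absurd hq (h.1 ▸ A.final_sink e)
  unfold pathSum
  rw [Fintype.sum_eq_single (⟨[], hq⟩ : A.PathsFrom q) (fun π hπ => absurd (h π) hπ)]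
  simp [pathWeight]

/-- Weight pushing only rescales the weights of the paths from a state to the final states. -/
theorem pathWeight_push {w : E → ℝ} (hw : ∀ e, 0 ≤ w e) : ∀ (l : List E) (q : Q),
    A.IsPathToFinal q l → A.pathSum w q ≠ 0 →
      pathWeight (A.push w) l = pathWeight w l / A.pathSum w q
  | [], q, h, _ => by rw [A.pathSum_final w h]; simp [pathWeight]
  | e :: l, q, h, hq => by
    obtain ⟨rfl, h2⟩ := h
    have e1 : pathWeight (A.push w) (e :: l) = A.push w e * pathWeight (A.push w) l := by
      simp [pathWeight]
    have e2 : pathWeight w (e :: l) = w e * pathWeight w l := by simp [pathWeight]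
    have e3 : A.push w e = (A.pathSum w (A.src e))⁻¹ * w e * A.pathSum w (A.tgt e) := by
      simp [push, hq]
    rw [e1, e2, e3]
    by_cases h0 : A.pathSum w (A.tgt e) = 0
    · have := (Finset.sum_eq_zero_iff_of_nonneg
        (fun (π : A.PathsFrom (A.tgt e)) _ => pathWeight_nonneg hw π.1)).1 h0 ⟨l, h2⟩
        (Finset.mem_univ _)
      simp only at this
      rw [h0, this]; simp
    · rw [pathWeight_push hw l _ h2 h0]
      field_simp

/-- Nonnegative transition weights for which `π ↦ ∏_{e ∈ π} w(e)` is a probability distribution on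
the accepting paths. -/
structure PathWeights where
  w : E → ℝ
  nonneg : ∀ e, 0 ≤ w e
  sum_eq_one : ∑ π : A.Path, pathWeight w π.1 = 1

/-- The weights that weight pushing makes out of nonnegative weights of positive total mass. -/
def PathWeights.ofPush (w : E → ℝ) (hw : ∀ e, 0 ≤ w e) (h : A.pathSum w A.init ≠ 0) :
    A.PathWeights where
  w := A.push w
  nonneg := A.push_nonneg hw
  sum_eq_one := by
    rw [Finset.sum_congr rfl fun (π : A.Path) _ => A.pathWeight_push hw π.1 A.init π.2 h,
      ← Finset.sum_div]
    exact div_self h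

/-- The initial weights: all transition weights one, then weight pushing (this is the uniform
distribution on the accepting paths). -/
def PathWeights.uniform (h : Nonempty A.Path) : A.PathWeights :=
  PathWeights.ofPush A (fun _ => 1) (fun _ => zero_le_one) (by simp [pathSum, pathWeight])

/-! ## The semi-bandit algorithm CDSB on an automaton with additive gains -/

/-- The parameters of the algorithm. -/
structure CDSBParams where
  η : ℝ
  β : ℝ
  γ : ℝ
  η_pos : 0 < η
  β_pos : 0 < β
  γ_pos : 0 < γ
  γ_lt_one : γ < 1

variable {A}
variable (prm : CDSBParams) (C : Finset A.Path)

open Classical in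
/-- The probability of the path `π` under the mixture `(1 - γ) p + γ μ`, where
`p(π) = ∏_{e ∈ π} w(e)` and `μ` is uniform on the covering paths `C`. -/
def mixProb (W : A.PathWeights) (π : A.Path) : ℝ :=
  (1 - prm.γ) * pathWeight W.w π.1 + prm.γ * (if π ∈ C then (C.card : ℝ)⁻¹ else 0)

theorem mixProb_nonneg (W : A.PathWeights) (π : A.Path) : 0 ≤ mixProb prm C W π := by
  have h1 := prm.γ_pos.le
  have h2 : 0 ≤ 1 - prm.γ := sub_nonneg.2 prm.γ_lt_one.le
  have h3 := pathWeight_nonneg W.nonneg π.1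
  unfold mixProb
  split_ifs <;> positivity

theorem sum_mixProb (hC : C.Nonempty) (W : A.PathWeights) : ∑ π, mixProb prm C W π = 1 := by
  classical
  unfold mixProb
  have hc : (C.card : ℝ) ≠ 0 := by exact_mod_cast hC.card_pos.ne'
  rw [Finset.sum_add_distrib, ← Finset.mul_sum, ← Finset.mul_sum, W.sum_eq_one]
  have : ∑ π : A.Path, (if π ∈ C then (C.card : ℝ)⁻¹ else 0) = 1 := by
    rw [Finset.sum_ite_mem, Finset.univ_inter, Finset.sum_const, nsmul_eq_mul]
    exact mul_inv_cancel₀ hc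
  rw [this]; ring

/-- The sampling distribution `(1 - γ) p + γ μ`. -/
def sampleDist (hC : C.Nonempty) (W : A.PathWeights) : PMF A.Path :=
  PMF.ofFintype (fun π => ENNReal.ofReal (mixProb prm C W π)) (by
    rw [← ENNReal.ofReal_sum_of_nonneg fun π _ => mixProb_nonneg prm C W π,
      sum_mixProb prm C hC W, ENNReal.ofReal_one])

open Classical in
/-- The flow through `e`: the probability that the sampled path contains `e`. -/
def flow (W : A.PathWeights) (e : E) : ℝ :=
  ∑ π : A.Path, if e ∈ π.1 then mixProb prm C W π else 0

open Classical in
/-- The surrogate gains after the path `π` has been sampled; of the gains `g` only those of the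
transitions of `π` are used. -/
def surrogateGain (W : A.PathWeights) (g : E → ℝ) (π : A.Path) (e : E) : ℝ :=
  if e ∈ π.1 then (g e + prm.β) / flow prm C W e else prm.β / flow prm C W e

/-- The updated weights `ŵ(e) = w(e) exp(η g̃(e))`, before weight pushing. -/
def rawUpdate (W : A.PathWeights) (g : E → ℝ) (π : A.Path) (e : E) : ℝ :=
  W.w e * Real.exp (prm.η * surrogateGain prm C W g π e)

theorem rawUpdate_nonneg (W : A.PathWeights) (g : E → ℝ) (π : A.Path) (e : E) :
    0 ≤ rawUpdate prm C W g π e :=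
  mul_nonneg (W.nonneg e) (Real.exp_pos _).le

theorem pathSum_rawUpdate_ne_zero (W : A.PathWeights) (g : E → ℝ) (π : A.Path) :
    A.pathSum (rawUpdate prm C W g π) A.init ≠ 0 := by
  intro h
  have h0 := (Finset.sum_eq_zero_iff_of_nonneg
    (fun (ρ : A.Path) _ => pathWeight_nonneg (rawUpdate_nonneg prm C W g π) ρ.1)).1 h
  have h1 : ∑ ρ : A.Path, pathWeight W.w ρ.1 = 0 := by
    refine Finset.sum_eq_zero fun ρ hρ => ?_
    have h2 := h0 ρ hρ
    unfold pathWeight rawUpdate at h2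
    rw [List.prod_map_mul] at h2
    refine (mul_eq_zero.1 h2).resolve_right (List.prod_ne_zero ?_)
    simp [Real.exp_ne_zero]
  exact one_ne_zero (W.sum_eq_one.symm.trans h1)

/-- One round of weight update: multiplicative update, then weight pushing. -/
def updateWeights (W : A.PathWeights) (g : E → ℝ) (π : A.Path) : A.PathWeights :=
  PathWeights.ofPush A (rawUpdate prm C W g π) (rawUpdate_nonneg prm C W g π)
    (pathSum_rawUpdate_ne_zero prm C W g π)

/-- The weights held after the history `h` of sampled paths (most recent first), where `gains h` is
the gain vector of the round that follows the history `h`. -/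
def weightsAfter (hC : C.Nonempty) (gains : List A.Path → E → ℝ) : List A.Path → A.PathWeights
  | [] => PathWeights.uniform A ⟨hC.choose⟩
  | π :: h => updateWeights prm C (weightsAfter hC gains h) (gains h) π

/-- The law of the list of the first `t` sampled paths (most recent first). -/
def runLaw (hC : C.Nonempty) (gains : List A.Path → E → ℝ) : ℕ → PMF (List A.Path)
  | 0 => PMF.pure []
  | t + 1 => (runLaw hC gains t).bind fun h =>
      (sampleDist prm C hC (weightsAfter prm C hC gains h)).map fun π => π :: h

/-- The accepting paths in `C` partition the set of transitions. -/
def IsPathPartition (C : Finset A.Path) : Prop := ∀ e : E, ∃! π : A.Path, π ∈ C ∧ e ∈ π.1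

end PathAutomaton

/-! ## Count-based gains -/

/-- The list of the contiguous factors of length `n` of `l`, from left to right. -/
def windows {α : Type*} (n : ℕ) (l : List α) : List (List α) :=
  (List.range (l.length + 1 - n)).map fun i => (l.drop i).take n

/-- The number of occurrences of the nonempty pattern `θ` in `y`. -/
def occurrences {α : Type*} [DecidableEq α] (θ y : List α) : ℕ := (windows θ.length y).count θ

/-- The count-based gain `Θ(x) · Θ(y)` for the set of patterns `Θ`. -/
def countGain {α : Type*} [DecidableEq α] (Θ : Finset (List α)) (x y : List α) : ℝ :=
  ∑ θ ∈ Θ, (occurrences θ x : ℝ) * (occurrences θ y : ℝ)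

/-! ## Ensemble structured prediction with `n`-gram gains -/

/-- `r` experts with `ℓ` substructures each, and `n`-gram gains. -/
structure Ensemble where
  r : ℕ
  ℓ : ℕ
  n : ℕ
  one_le_r : 1 ≤ r
  one_le_n : 1 ≤ n
  n_le_ℓ : n ≤ ℓ

namespace Ensemble

variable (P : Ensemble)

theorem acyclic_of_rank {Q E : Type*} {src tgt : E → Q} (rk : Q → ℕ)
    (h : ∀ e, rk (src e) < rk (tgt e)) (q : Q) :
    ¬ Relation.TransGen (fun a b => ∃ e, src e = a ∧ tgt e = b) q q := by
  intro hq
  have : ∀ a b, Relation.TransGen (fun a b => ∃ e, src e = a ∧ tgt e = b) a b → rk a < rk b := by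
    intro a b hab
    induction hab with
    | single hab => obtain ⟨e, rfl, rfl⟩ := hab; exact h e
    | tail _ hab ih => obtain ⟨e, rfl, rfl⟩ := hab; exact ih.trans (h e)
  exact lt_irrefl _ (this q q hq)

/-- The transitions of the expert automaton: `(i, j)` stands for the substructure number `i + 1` of
the expert number `j + 1`. -/
abbrev Edge := Fin P.ℓ × Fin P.r

/-- The expert automaton: states `0, …, ℓ`, with `r` parallel transitions from each state to the
next one. -/
def expertAutomaton : PathAutomaton (Fin (P.ℓ + 1)) P.Edge where
  src e := e.1.castSucc
  tgt e := e.1.succ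
  init := 0
  final := {Fin.last P.ℓ}
  acyclic := acyclic_of_rank (fun q => q.1) (by intro e; simp)
  final_sink e h := by
    have h1 := congrArg Fin.val (Set.mem_singleton_iff.1 h)
    have h2 := e.1.2
    simp only [Fin.val_castSucc, Fin.val_last] at h1
    omega

/-- The transitions of the context-dependent automaton: `(i, w)` stands for the `n`-gram
`#h_{w 0, i+1} h_{w 1, i+2} ⋯ h_{w (n-1), i+n}` (with `i` ranging over `0, …, ℓ - n`). -/
abbrev CtxEdge := Fin (P.ℓ - P.n + 1) × (Fin P.n → Fin P.r)

/-- The states of the context-dependent automaton: the initial state, and `mem i u` in layer `i + 1`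
(layers `1, …, ℓ - n + 1`), which remembers the last `n - 1` transitions read. -/
inductive CtxState
  | start : CtxState
  | mem (i : Fin (P.ℓ - P.n + 1)) (u : Fin (P.n - 1) → Fin P.r) : CtxState

variable {P}

/-- The first `n - 1` letters of an `n`-gram. -/
def firsts (w : Fin P.n → Fin P.r) (k : Fin (P.n - 1)) : Fin P.r := w ⟨k.1, by omega⟩

/-- The last `n - 1` letters of an `n`-gram. -/
def lasts (w : Fin P.n → Fin P.r) (k : Fin (P.n - 1)) : Fin P.r := w ⟨k.1 + 1, by omega⟩

/-- The `n`-gram `(0, w)` leaves the initial state; for `i > 0`, `(i, w)` leaves the state of layer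
`i` whose memory is the first `n - 1` letters of `w`. -/
def ctxSrc (e : P.CtxEdge) : P.CtxState :=
  if e.1.1 = 0 then .start else .mem ⟨e.1.1 - 1, by omega⟩ (firsts e.2)

/-- `(i, w)` enters the state of layer `i + 1` whose memory is the last `n - 1` letters of `w`. -/
def ctxTgt (e : P.CtxEdge) : P.CtxState := .mem e.1 (lasts e.2)

/-- The layer of a state. -/
def ctxLayer : P.CtxState → ℕ
  | .start => 0
  | .mem i _ => i.1 + 1

variable (P)

theorem ctxLayer_src (e : P.CtxEdge) : ctxLayer (ctxSrc e) = e.1.1 := by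
  unfold ctxSrc
  split_ifs with h
  · simp [ctxLayer, h]
  · simp only [ctxLayer]; omega

/-- The context-dependent automaton: each non-final state has as outgoing transitions the `n`-grams
that extend its memory (all `n`-grams at the beginning, for the initial state). -/
def ctxAutomaton : PathAutomaton P.CtxState P.CtxEdge where
  src := ctxSrc
  tgt := ctxTgt
  init := .start
  final := {q | ctxLayer q = P.ℓ - P.n + 1}
  acyclic := acyclic_of_rank ctxLayer (by intro e; rw [P.ctxLayer_src]; simp [ctxTgt, ctxLayer])
  final_sink e h := by
    have h1 : ctxLayer (ctxSrc e) = P.ℓ - P.n + 1 := h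
    rw [P.ctxLayer_src] at h1
    exact absurd h1 e.1.2.ne

variable {P}

/-- The name of a transition of the context-dependent automaton: the `n`-gram of transitions of the
expert automaton that it glues together. -/
def gram (e : P.CtxEdge) : List P.Edge :=
  List.ofFn fun k : Fin P.n => (⟨e.1.1 + k.1, by have := P.n_le_ℓ; omega⟩, e.2 k)

/-- The accepting path `π'` is the result of rewriting the accepting path `π`: its transition names
are the `n`-grams of `π`, in this order. -/
def Rewrites (π : P.expertAutomaton.Path) (π' : P.ctxAutomaton.Path) : Prop :=
  windows P.n π.1 = π'.1.map gram

theorem windows_cons {α : Type*} (n : ℕ) (a : α) (l : List α) (h : n ≤ l.length + 1) :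
    windows n (a :: l) = (a :: l).take n :: windows n l := by
  unfold windows
  rw [List.length_cons, show l.length + 1 + 1 - n = (l.length + 1 - n) + 1 by omega,
    List.range_succ_eq_map]
  simp [Function.comp_def]

theorem gram_isPath (i : ℕ) (m : ℕ) (hm : i + m = P.ℓ) (w : Fin m → Fin P.r) :
    P.expertAutomaton.IsPathToFinal ⟨i, by omega⟩
      (List.ofFn fun k : Fin m => ((⟨i + k.1, by omega⟩ : Fin P.ℓ), w k)) := by
  induction m generalizing i with
  | zero =>
    simp only [List.ofFn_zero, PathAutomaton.IsPathToFinal, expertAutomaton,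
      Set.mem_singleton_iff, Fin.ext_iff, Fin.val_last]
    omega
  | succ m ih =>
    rw [List.ofFn_succ]
    refine ⟨by simp [expertAutomaton], ?_⟩
    have := ih (i + 1) (by omega) (fun k => w k.succ)
    convert this using 3
    · simp [expertAutomaton]
    · refine Prod.ext (Fin.ext ?_) rfl
      simp only [Fin.val_succ]
      omega

theorem gram_eq_of_src_eq_tgt {e e' : P.CtxEdge} (h : ctxSrc e' = ctxTgt e) (l : List P.Edge)
    (hl : gram e' <+: l) :
    ∃ x : P.Edge, x.1 = ⟨e.1.1, by have := P.n_le_ℓ; have := P.one_le_n; omega⟩ ∧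
      e'.1.1 = e.1.1 + 1 ∧ (x :: l).take P.n = gram e := by
  have hn := P.one_le_n
  have hnl := P.n_le_ℓ
  unfold ctxSrc ctxTgt at h
  split_ifs at h with h0
  injection h with h1 h2
  have h1' : e'.1.1 - 1 = e.1.1 := by rw [← h1]
  refine ⟨(⟨e.1.1, by omega⟩, e.2 ⟨0, hn⟩), rfl, by omega, ?_⟩
  obtain ⟨t, rfl⟩ := hl
  apply List.ext_getElem
  · simp only [List.length_take, List.length_cons, List.length_append, gram, List.length_ofFn]
    omega
  · intro k hk hk'
    have hk2 : k < P.n := by simpa [gram] using hk'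
    rw [List.getElem_take]
    rcases k with _ | k
    · simp [gram]
    · rw [List.getElem_cons_succ, List.getElem_append_left (by simp [gram]; omega)]
      have h3 := congrFun h2 ⟨k, by omega⟩
      simp only [firsts, lasts] at h3
      simp only [gram, List.getElem_ofFn, Prod.mk.injEq, Fin.mk.injEq]
      exact ⟨by omega, h3⟩

theorem exists_unrewrite_aux : ∀ (l : List P.CtxEdge) (e : P.CtxEdge),
    P.ctxAutomaton.IsPathToFinal (ctxTgt e) l →
      ∃ π : List P.Edge, P.expertAutomaton.IsPathToFinal ⟨e.1.1, by omega⟩ π ∧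
        gram e <+: π ∧ windows P.n π = gram e :: l.map gram
  | [], e, h => by
    have hnl := P.n_le_ℓ
    have h' : e.1.1 + 1 = P.ℓ - P.n + 1 := h
    have hlen : (gram e).length = P.n := by simp [gram]
    refine ⟨gram e, gram_isPath e.1.1 P.n (by omega) e.2, List.prefix_rfl, ?_⟩
    unfold windows
    rw [hlen, show P.n + 1 - P.n = 1 by omega]
    simp [← hlen]
  | e' :: l, e, h => by
    have hnl := P.n_le_ℓ
    obtain ⟨h1, h2⟩ := h
    obtain ⟨π, hπ, hpre, hwin⟩ := exists_unrewrite_aux l e' h2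
    obtain ⟨x, hx1, hx2, hx3⟩ := gram_eq_of_src_eq_tgt h1 π hpre
    have hlen : (gram e').length = P.n := by simp [gram]
    have hle := hpre.length_le
    refine ⟨x :: π, ⟨?_, ?_⟩, ?_, ?_⟩
    · simp [expertAutomaton, hx1]
    · convert hπ using 1
      simp [expertAutomaton, hx1, hx2]
    · rw [← hx3]; exact List.take_prefix _ _
    · rw [windows_cons _ _ _ (by omega), hx3, hwin]; rfl

theorem exists_unrewrite (π' : P.ctxAutomaton.Path) : ∃ π, Rewrites π π' := by
  obtain ⟨_ | ⟨e, l⟩, h⟩ := π'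
  · have : (0 : ℕ) = P.ℓ - P.n + 1 := h
    omega
  · obtain ⟨h1, h2⟩ := h
    obtain ⟨π, hπ, -, hwin⟩ := exists_unrewrite_aux l e h2
    have h0 : e.1.1 = 0 := by
      rw [← P.ctxLayer_src]; exact congrArg ctxLayer h1
    refine ⟨⟨π, ?_⟩, hwin⟩
    convert hπ using 1
    simp [expertAutomaton, h0]

/-- The path expert that the learner follows when the path `π'` has been sampled. -/
def unrewrite (π' : P.ctxAutomaton.Path) : P.expertAutomaton.Path := (exists_unrewrite π').choose

variable {α : Type*} [DecidableEq α]

variable (P α) in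
/-- What the adversary fixes in a round: the symbol output by every transition of the expert
automaton, and the target sequence. -/
structure Round where
  out : P.Edge → α
  target : List α

variable (P α) in
/-- An adversary, which may be adaptive: its choice for a round is a function of the paths that the
learner sampled in the earlier rounds (most recent first). -/
abbrev Adversary := List P.ctxAutomaton.Path → P.Round α

/-- The gain of a transition of the context-dependent automaton. -/
def transitionGain (Θ : Finset (List α)) (ρ : P.Round α) (e : P.CtxEdge) : ℝ :=
  if (gram e).map ρ.out ∈ Θ then (occurrences ((gram e).map ρ.out) ρ.target : ℝ) else 0

/-- The gain of a path expert. -/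
def pathGain (Θ : Finset (List α)) (ρ : P.Round α) (π : P.expertAutomaton.Path) : ℝ :=
  countGain Θ (π.1.map ρ.out) ρ.target

/-- The regret against the path expert `πs` over the rounds in which the learner sampled the given
paths (most recent first). -/
def regret (Θ : Finset (List α)) (adv : P.Adversary α) (πs : P.expertAutomaton.Path) :
    List P.ctxAutomaton.Path → ℝ
  | [] => 0
  | π' :: h => regret Θ adv πs h +
      (pathGain Θ (adv h) πs - pathGain Θ (adv h) (unrewrite π'))

/-- The law of the paths sampled by CDSB in the first `t` rounds (most recent first). -/
def cdsbLaw (prm : PathAutomaton.CDSBParams) (C : Finset P.ctxAutomaton.Path) (hC : C.Nonempty)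
    (Θ : Finset (List α)) (adv : P.Adversary α) (t : ℕ) : PMF (List P.ctxAutomaton.Path) :=
  PathAutomaton.runLaw prm C hC (fun h => transitionGain Θ (adv h)) t

end Ensemble

end

/-! In terms of the `n`-grams that an expert path reads, the count-based gain is additive: it is the
sum of the gains of the transitions of the rewritten path (`pathGain_eq`). The game is therefore an
online path problem with semi-bandit feedback, on an automaton with at most `r ^ ℓ` accepting paths,
each with `N = ℓ - n + 1` transitions out of `r ^ n * N`. The covering paths are those of the words
with period `n`: an `n`-gram at a given position fixes one full period, hence the word.

The regret bound joins a deterministic and a probabilistic estimate. The deterministic one follows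
the potential `expTotal`, the sum over paths of exp(η · total surrogate gain). By e^x ≤ 1 + x + x²,
one round multiplies it by an exponential (`sum_pathWeight_mul_exp_le`) whose first-order part is
the played gain plus the bias β per transition, and whose second-order part is a small multiple of
the surrogate gains summed over all transitions. Since the covering paths partition the transitions,
that sum is at most |C| times the surrogate total M of the best path. Comparing the potential with
its largest term exp(η M) bounds M by the played gain plus an overhead
(`regret_le_of_gainTotal_le`).

The probabilistic one replaces M by true gains. The bias β makes exp((β/B²)(true total − surrogate
total)) a supermartingale for each transition, even against an adaptive adversary
(`tsum_runLaw_mul_exp_le_one`). Markov's inequality and a union bound over transitions show that no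
surrogate total falls far below the true one (`toOuterMeasure_gainTotal_le`). The parameters then
balance the overhead terms; for T too small to allow them, the claimed bound exceeds the trivial
one. -/

/-! ### Exponential moments and Markov's inequality -/

theorem Real.exp_le_one_add_add_sq {x : ℝ} (hx : x ≤ 1) : Real.exp x ≤ 1 + x + x ^ 2 := by
  by_cases h : -1 ≤ x
  · have := (abs_le.1 (Real.abs_exp_sub_one_sub_id_le (abs_le.2 ⟨h, hx⟩))).2
    linarith
  · push Not at h
    have : Real.exp x ≤ 1 := Real.exp_le_one_iff.2 (by linarith)
    nlinarith

/-- The exponential moment of a biased importance-weighted estimate of a bounded gain. -/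
theorem exp_moment_importance_weighted {q g B β : ℝ} (hq : 0 < q) (hg : 0 ≤ g)
    (hgB : g ≤ B) (hβ : 0 < β) (hβB : β ≤ B) (hq1 : q ≤ 1) :
    q * Real.exp (β / B ^ 2 * (g - (g + β) / q)) +
      (1 - q) * Real.exp (β / B ^ 2 * (g - β / q)) ≤ 1 := by
  have hB : 0 < B := hβ.trans_le hβB
  set c := β / B ^ 2 with hc
  have hc0 : 0 < c := by positivity
  have hcB : c * B ≤ 1 := by
    rw [hc, div_mul_eq_mul_div, div_le_one (by positivity)]; nlinarith
  have hcg : c * g ≤ 1 := (mul_le_mul_of_nonneg_left hgB hc0.le).trans hcB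
  -- The bias β contributes the common factor exp(-cβ/q), which has to pay for the variance of the
  -- unbiased importance-weighted estimate.
  have h1 : c * (g - (g + β) / q) = c * (g - g / q) + -(c * β / q) := by ring
  have h2 : c * (g - β / q) = c * g + -(c * β / q) := by ring
  have hgq : g ≤ g / q := by rw [le_div_iff₀ hq]; nlinarith
  rw [h1, h2, Real.exp_add, Real.exp_add]
  have e1 := Real.exp_le_one_add_add_sq (x := c * (g - g / q)) (by nlinarith)
  have e2 := Real.exp_le_one_add_add_sq hcg
  have key : q * Real.exp (c * (g - g / q)) + (1 - q) * Real.exp (c * g) ≤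
      Real.exp (c * β / q) := by
    have e3 := Real.add_one_le_exp (c * β / q)
    -- The linear terms cancel because g/q with probability q, and 0 otherwise, has mean g; only the
    -- variance c²g²(1/q - 1) survives.
    have e4 : q * (1 + c * (g - g / q) + (c * (g - g / q)) ^ 2) +
        (1 - q) * (1 + c * g + (c * g) ^ 2) = 1 + c ^ 2 * g ^ 2 / q - c ^ 2 * g ^ 2 := by
      field_simp; ring
    -- The value c = β/B² is chosen so that c²B² = cβ: the bias dominates the variance term.
    have e5 : c ^ 2 * g ^ 2 / q ≤ c * β / q := by
      have : c * β = c ^ 2 * B ^ 2 := by rw [hc]; field_simp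
      rw [this]; gcongr
    have e6 := mul_le_mul_of_nonneg_left e1 hq.le
    have e7 := mul_le_mul_of_nonneg_left e2 (sub_nonneg.2 hq1)
    have e8 : 0 ≤ c ^ 2 * g ^ 2 := by positivity
    linarith
  calc _ = (q * Real.exp (c * (g - g / q)) + (1 - q) * Real.exp (c * g)) *
        Real.exp (-(c * β / q)) := by ring
    _ ≤ Real.exp (c * β / q) * Real.exp (-(c * β / q)) := by gcongr
    _ = 1 := by rw [← Real.exp_add]; simp

theorem PMF.tsum_bind_mul {α β : Type*} (p : PMF α) (k : α → PMF β) (f : β → ENNReal) :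
    ∑' b, (p.bind k) b * f b = ∑' a, p a * ∑' b, k a b * f b := by
  simp_rw [PMF.bind_apply, ← ENNReal.tsum_mul_right, ← ENNReal.tsum_mul_left]
  rw [ENNReal.tsum_comm]
  simp_rw [mul_assoc]

theorem PMF.tsum_map_mul {α β : Type*} (p : PMF α) (k : α → β) (f : β → ENNReal) :
    ∑' b, (p.map k) b * f b = ∑' a, p a * f (k a) := by
  rw [← PMF.bind_pure_comp, PMF.tsum_bind_mul]
  refine tsum_congr fun a => ?_
  congr 1
  rw [tsum_eq_single (k a)]
  · simp
  · intro b hb; simp [hb]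

/-- Markov's inequality for a nonnegative function of mean at most one. -/
theorem PMF.toOuterMeasure_le_of_tsum_mul_le_one {α : Type*} (p : PMF α) (f : α → ENNReal)
    (hf : ∑' a, p a * f a ≤ 1) (c : ENNReal) (s : Set α) (hs : ∀ a ∈ s, 1 ≤ c * f a) :
    p.toOuterMeasure s ≤ c := by
  rw [PMF.toOuterMeasure_apply]
  calc ∑' a, s.indicator p a ≤ ∑' a, c * (p a * f a) := by
        refine ENNReal.tsum_le_tsum fun a => ?_
        by_cases ha : a ∈ s
        · rw [Set.indicator_of_mem ha, mul_left_comm]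
          exact le_mul_of_one_le_right' (hs a ha)
        · rw [Set.indicator_of_notMem ha]; exact zero_le
    _ = c * ∑' a, p a * f a := ENNReal.tsum_mul_left
    _ ≤ c := mul_le_of_le_one_right' hf

/-! ### Surrogate gains and the growth of the potential in one round -/

namespace PathAutomaton

variable {Q E : Type*} {A : PathAutomaton Q E}

open Classical in
theorem sum_map_eq_sum_ite [Fintype E] (π : A.Path) (f : E → ℝ) :
    (π.1.map f).sum = ∑ e, if e ∈ π.1 then f e else 0 := by
  rw [← List.sum_toFinset f (A.nodup_of_isPathToFinal _ _ π.2), ← Finset.sum_filter]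
  congr 1
  ext e; simp

theorem sum_map_nonneg {f : E → ℝ} (hf : ∀ e, 0 ≤ f e) (l : List E) : 0 ≤ (l.map f).sum :=
  List.sum_nonneg (by simpa using fun e _ => hf e)

theorem sum_map_le {f : E → ℝ} {b : ℝ} (hf : ∀ e, f e ≤ b) (l : List E) :
    (l.map f).sum ≤ l.length * b := by
  simpa using List.sum_le_card_nsmul (l.map f) b (by simpa using fun e _ => hf e)

/-- Each transition is counted once because it lies on exactly one path of `C`; this is how a total
over all transitions becomes at most |C| times the total of the best path. -/
theorem IsPathPartition.sum_eq [Fintype E] {C : Finset A.Path} (hP : IsPathPartition C)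
    (f : E → ℝ) : ∑ e, f e = ∑ π ∈ C, (π.1.map f).sum := by
  classical
  simp_rw [sum_map_eq_sum_ite]
  rw [Finset.sum_comm]
  refine Finset.sum_congr rfl fun e _ => ?_
  obtain ⟨π, ⟨h1, h2⟩, h3⟩ := hP e
  rw [Finset.sum_eq_single_of_mem π h1, if_pos h2]
  intro ρ hρ hne
  exact if_neg fun h => hne (h3 ρ ⟨hρ, h⟩)

section Flow

variable [Finite E] (prm : CDSBParams) (C : Finset A.Path)

/-- Exploration alone guarantees this much: some path of `C` contains the transition and is sampled
with probability at least γ/|C|. -/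
theorem flow_ge (hP : IsPathPartition C) (W : A.PathWeights) (e : E) :
    prm.γ / C.card ≤ flow prm C W e := by
  classical
  obtain ⟨π, ⟨h1, h2⟩, -⟩ := hP e
  have h0 : prm.γ / C.card ≤ mixProb prm C W π := by
    unfold mixProb
    rw [if_pos h1, div_eq_mul_inv]
    have := mul_nonneg (sub_nonneg.2 prm.γ_lt_one.le) (pathWeight_nonneg W.nonneg π.1)
    linarith
  refine h0.trans ?_
  unfold flow
  refine le_trans (le_of_eq ?_) (Finset.single_le_sum (fun ρ _ => ?_) (Finset.mem_univ π))
  · rw [if_pos h2]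
  · split_ifs
    · exact mixProb_nonneg ..
    · exact le_rfl

theorem flow_pos (hC : C.Nonempty) (hP : IsPathPartition C) (W : A.PathWeights) (e : E) :
    0 < flow prm C W e :=
  (div_pos prm.γ_pos (by exact_mod_cast hC.card_pos)).trans_le (flow_ge prm C hP W e)

theorem flow_le_one (hC : C.Nonempty) (W : A.PathWeights) (e : E) : flow prm C W e ≤ 1 := by
  classical
  rw [← sum_mixProb prm C hC W]
  unfold flow
  refine Finset.sum_le_sum fun π _ => ?_
  split_ifs
  · exact le_rfl
  · exact mixProb_nonneg ..

theorem sum_mixProb_mul_sum_map [Fintype E] (W : A.PathWeights) (f : E → ℝ) :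
    ∑ π : A.Path, mixProb prm C W π * (π.1.map f).sum = ∑ e, flow prm C W e * f e := by
  classical
  simp_rw [sum_map_eq_sum_ite, Finset.mul_sum, flow, Finset.sum_mul]
  rw [Finset.sum_comm]
  refine Finset.sum_congr rfl fun e _ => Finset.sum_congr rfl fun π _ => ?_
  split_ifs <;> simp

open Classical in
-- The importance weight cancels, so averaging over the sampling distribution turns surrogate gains
-- back into played gains plus the bias.
theorem flow_mul_surrogateGain (hC : C.Nonempty) (hP : IsPathPartition C) (W : A.PathWeights)
    (g : E → ℝ) (π : A.Path) (e : E) :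
    flow prm C W e * surrogateGain prm C W g π e = (if e ∈ π.1 then g e else 0) + prm.β := by
  have := (flow_pos prm C hC hP W e).ne'
  unfold surrogateGain
  split_ifs <;> field_simp
  ring

theorem surrogateGain_nonneg (hC : C.Nonempty) (hP : IsPathPartition C) (W : A.PathWeights)
    {g : E → ℝ} (hg : ∀ e, 0 ≤ g e) (π : A.Path) (e : E) :
    0 ≤ surrogateGain prm C W g π e := by
  have h1 := flow_pos prm C hC hP W e
  have h2 := prm.β_pos
  have h3 := hg e
  unfold surrogateGain
  split_ifs <;> positivity

theorem surrogateGain_le (hC : C.Nonempty) (hP : IsPathPartition C) (W : A.PathWeights)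
    {g : E → ℝ} {B : ℝ} (hg : ∀ e, 0 ≤ g e) (hB : ∀ e, g e ≤ B) (π : A.Path) (e : E) :
    surrogateGain prm C W g π e ≤ (B + prm.β) * C.card / prm.γ := by
  classical
  have hc : (0 : ℝ) < C.card := by exact_mod_cast hC.card_pos
  have h1 := flow_ge prm C hP W e
  have h2 := flow_pos prm C hC hP W e
  have hγ := prm.γ_pos
  have hβ := prm.β_pos
  have hgB : 0 ≤ B := (hg e).trans (hB e)
  have h3 : flow prm C W e * surrogateGain prm C W g π e ≤ B + prm.β := by
    rw [flow_mul_surrogateGain prm C hC hP]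
    split_ifs
    · linarith [hB e]
    · linarith
  have h4 := mul_le_mul_of_nonneg_right h1 (surrogateGain_nonneg prm C hC hP W hg π e)
  rw [le_div_iff₀ hγ]
  have h5 := h4.trans h3
  rw [div_mul_eq_mul_div, div_le_iff₀ hc] at h5
  linarith

/-- The growth of the total weight in one round. -/
theorem sum_pathWeight_mul_exp_le [Fintype E] (hC : C.Nonempty) (hP : IsPathPartition C)
    (W : A.PathWeights) {g : E → ℝ} {B : ℝ} (hg : ∀ e, 0 ≤ g e) (hB : ∀ e, g e ≤ B) (hB0 : 0 ≤ B)
    {N : ℕ} (hN : ∀ ρ : A.Path, ρ.1.length = N)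
    (hη : prm.η * N * (B + prm.β) * C.card ≤ prm.γ) (π : A.Path) :
    ∑ ρ : A.Path, pathWeight W.w ρ.1 *
        Real.exp (prm.η * (ρ.1.map (surrogateGain prm C W g π)).sum) ≤
      Real.exp (prm.η / (1 - prm.γ) *
        ((π.1.map g).sum + prm.β * Fintype.card E +
          prm.η * N * (B + prm.β) * ∑ e, surrogateGain prm C W g π e)) := by
  classical
  set s := surrogateGain prm C W g π with hs
  have hs0 : ∀ e, 0 ≤ s e := surrogateGain_nonneg prm C hC hP W hg π
  have hη0 := prm.η_pos
  have hγ0 := prm.γ_pos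
  have hγ : 0 < 1 - prm.γ := sub_pos.2 prm.γ_lt_one
  have hβ := prm.β_pos
  have hp : ∀ ρ : A.Path, 0 ≤ pathWeight W.w ρ.1 := fun ρ => pathWeight_nonneg W.nonneg _
  have hS0 : ∀ ρ : A.Path, 0 ≤ (ρ.1.map s).sum := fun ρ => sum_map_nonneg hs0 _
  -- This is the range in which e^x ≤ 1 + x + x² is available; `hη` is tailored to it.
  have hS1 : ∀ ρ : A.Path, prm.η * (ρ.1.map s).sum ≤ 1 := fun ρ => by
    have h1 := sum_map_le (surrogateGain_le prm C hC hP W hg hB π) ρ.1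
    rw [hN ρ] at h1
    calc _ ≤ prm.η * (N * ((B + prm.β) * C.card / prm.γ)) := by gcongr
      _ = prm.η * N * (B + prm.β) * C.card / prm.γ := by ring
      _ ≤ 1 := (div_le_one hγ0).2 hη
  -- Passing from p to the mixture costs a factor 1/(1 - γ), but makes the flow appear, which
  -- cancels the importance weights.
  have hpm : ∀ ρ : A.Path, (1 - prm.γ) * pathWeight W.w ρ.1 ≤ mixProb prm C W ρ := fun ρ => by
    unfold mixProb
    have : 0 ≤ prm.γ * (if ρ ∈ C then (C.card : ℝ)⁻¹ else 0) := by split_ifs <;> positivity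
    linarith
  -- Cauchy–Schwarz over the N distinct transitions of the path.
  have hS2 : ∀ ρ : A.Path, ((ρ.1.map s).sum) ^ 2 ≤ N * (ρ.1.map fun e => s e ^ 2).sum := fun ρ => by
    have hnd := A.nodup_of_isPathToFinal _ _ ρ.2
    rw [← List.sum_toFinset _ hnd, ← List.sum_toFinset _ hnd]
    have := sq_sum_le_card_mul_sum_sq (s := ρ.1.toFinset) (f := s)
    rwa [List.toFinset_card_of_nodup hnd, hN ρ] at this
  have hfirst : (1 - prm.γ) * ∑ ρ : A.Path, pathWeight W.w ρ.1 * (ρ.1.map s).sum ≤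
      (π.1.map g).sum + prm.β * Fintype.card E := by
    calc _ = ∑ ρ : A.Path, (1 - prm.γ) * pathWeight W.w ρ.1 * (ρ.1.map s).sum := by
          rw [Finset.mul_sum]; simp_rw [mul_assoc]
      _ ≤ ∑ ρ : A.Path, mixProb prm C W ρ * (ρ.1.map s).sum :=
          Finset.sum_le_sum fun ρ _ => mul_le_mul_of_nonneg_right (hpm ρ) (hS0 ρ)
      _ = _ := by
          rw [sum_mixProb_mul_sum_map]
          simp_rw [hs, flow_mul_surrogateGain prm C hC hP]
          rw [Finset.sum_add_distrib, ← sum_map_eq_sum_ite]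
          simp [mul_comm]
  have hsecond : (1 - prm.γ) * ∑ ρ : A.Path, pathWeight W.w ρ.1 * ((ρ.1.map s).sum) ^ 2 ≤
      N * (B + prm.β) * ∑ e, s e := by
    calc _ = ∑ ρ : A.Path, (1 - prm.γ) * pathWeight W.w ρ.1 * ((ρ.1.map s).sum) ^ 2 := by
          rw [Finset.mul_sum]; simp_rw [mul_assoc]
      _ ≤ ∑ ρ : A.Path, mixProb prm C W ρ * (N * (ρ.1.map fun e => s e ^ 2).sum) :=
          Finset.sum_le_sum fun ρ _ => mul_le_mul (hpm ρ) (hS2 ρ) (sq_nonneg _)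
            (mixProb_nonneg ..)
      _ = N * ∑ e, flow prm C W e * s e ^ 2 := by
          rw [← sum_mixProb_mul_sum_map, Finset.mul_sum]
          exact Finset.sum_congr rfl fun ρ _ => by ring
      -- The flow absorbs one of the two factors s(e), since their product is at most B + β.
      _ ≤ N * ∑ e, (B + prm.β) * s e := by
          refine mul_le_mul_of_nonneg_left (Finset.sum_le_sum fun e _ => ?_) (Nat.cast_nonneg N)
          rw [sq, ← mul_assoc]
          refine mul_le_mul_of_nonneg_right ?_ (hs0 e)
          rw [hs, flow_mul_surrogateGain prm C hC hP]
          split_ifs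
          · linarith [hB e]
          · linarith
      _ = _ := by rw [← Finset.mul_sum]; ring
  calc _ ≤ ∑ ρ : A.Path, pathWeight W.w ρ.1 *
        (1 + prm.η * (ρ.1.map s).sum + (prm.η * (ρ.1.map s).sum) ^ 2) :=
        Finset.sum_le_sum fun ρ _ =>
          mul_le_mul_of_nonneg_left (Real.exp_le_one_add_add_sq (hS1 ρ)) (hp ρ)
    _ = 1 + prm.η * ∑ ρ : A.Path, pathWeight W.w ρ.1 * (ρ.1.map s).sum +
        prm.η ^ 2 * ∑ ρ : A.Path, pathWeight W.w ρ.1 * ((ρ.1.map s).sum) ^ 2 := by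
        conv_rhs => rw [← W.sum_eq_one, Finset.mul_sum, Finset.mul_sum,
          ← Finset.sum_add_distrib, ← Finset.sum_add_distrib]
        exact Finset.sum_congr rfl fun ρ _ => by ring
    _ ≤ 1 + prm.η * (((π.1.map g).sum + prm.β * Fintype.card E) / (1 - prm.γ)) +
        prm.η ^ 2 * (N * (B + prm.β) * (∑ e, s e) / (1 - prm.γ)) := by
        gcongr
        · rw [le_div_iff₀ hγ]; linarith
        · rw [le_div_iff₀ hγ]; linarith
    _ = prm.η / (1 - prm.γ) * ((π.1.map g).sum + prm.β * Fintype.card E +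
          prm.η * N * (B + prm.β) * ∑ e, s e) + 1 := by ring
    _ ≤ _ := Real.add_one_le_exp _

end Flow

/-- The total gain of a transition along a history. -/
def gainTotal (gains : List A.Path → E → ℝ) : List A.Path → E → ℝ
  | [], _ => 0
  | _ :: h, e => gainTotal gains h e + gains h e

/-- The total gain of the paths of a history. -/
def playedGain (gains : List A.Path → E → ℝ) : List A.Path → ℝ
  | [] => 0
  | π :: h => playedGain gains h + (π.1.map (gains h)).sum

/-- The gains of the rounds after histories shorter than `T` lie in `[0, B]`. -/
def GainsBounded (gains : List A.Path → E → ℝ) (T : ℕ) (B : ℝ) : Prop :=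
  ∀ h : List A.Path, h.length < T → ∀ e, 0 ≤ gains h e ∧ gains h e ≤ B

theorem gainTotal_le {gains : List A.Path → E → ℝ} {T : ℕ} {B : ℝ}
    (hg : GainsBounded gains T B) (e : E) :
    ∀ h : List A.Path, h.length ≤ T → gainTotal gains h e ≤ h.length * B
  | [], _ => by simp [gainTotal]
  | π :: h, hT => by
    rw [List.length_cons] at hT ⊢
    have h1 := gainTotal_le hg e h (by omega)
    have h2 := (hg h (by omega) e).2
    simp only [gainTotal]
    push_cast
    linarith

/-! ### The potential along a run -/

section Run

variable [Finite E] (prm : CDSBParams) {C : Finset A.Path} (hC : C.Nonempty)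
  (gains : List A.Path → E → ℝ)

/-- The total surrogate gain of a transition along a history. -/
noncomputable def surrTotal : List A.Path → E → ℝ
  | [], _ => 0
  | π :: h, e => surrTotal h e +
      surrogateGain prm C (weightsAfter prm C hC gains h) (gains h) π e

/-- The total exponential weight of the accepting paths after a history. -/
noncomputable def expTotal (h : List A.Path) : ℝ :=
  ∑ ρ : A.Path, Real.exp (prm.η * (ρ.1.map (surrTotal prm hC gains h)).sum)

theorem expTotal_pos (h : List A.Path) : 0 < expTotal prm hC gains h :=
  Finset.sum_pos (fun _ _ => Real.exp_pos _) ⟨hC.choose, Finset.mem_univ _⟩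

theorem sum_map_surrTotal_cons (π : A.Path) (h : List A.Path) (l : List E) :
    (l.map (surrTotal prm hC gains (π :: h))).sum = (l.map (surrTotal prm hC gains h)).sum +
      (l.map (surrogateGain prm C (weightsAfter prm C hC gains h) (gains h) π)).sum := by
  rw [← List.sum_map_add]
  rfl

theorem pathWeight_rawUpdate (W : A.PathWeights) (g : E → ℝ) (π : A.Path) (l : List E) :
    pathWeight (rawUpdate prm C W g π) l =
      pathWeight W.w l * Real.exp (prm.η * (l.map (surrogateGain prm C W g π)).sum) := by
  induction l with
  | nil => simp [pathWeight]
  | cons e l ih =>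
    simp only [pathWeight, List.map_cons, List.prod_cons, List.sum_cons] at ih ⊢
    rw [ih, mul_add, Real.exp_add, rawUpdate]
    ring

/-- Weight pushing divides every path weight by the same constant, so the local updates maintain
exactly the exponential weights distribution on paths. -/
theorem pathWeight_weightsAfter (h : List A.Path) (ρ : A.Path) :
    pathWeight (weightsAfter prm C hC gains h).w ρ.1 =
      Real.exp (prm.η * (ρ.1.map (surrTotal prm hC gains h)).sum) / expTotal prm hC gains h := by
  induction h generalizing ρ with
  | nil =>
    have hne : A.pathSum (fun _ => (1 : ℝ)) A.init ≠ 0 := by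
      have : Nonempty A.Path := ⟨hC.choose⟩
      simp [pathSum, pathWeight]
    change pathWeight (A.push fun _ => 1) ρ.1 = _
    rw [A.pathWeight_push (fun _ => zero_le_one) _ _ ρ.2 hne]
    simp [expTotal, pathSum, pathWeight, surrTotal]
  | cons π h ih =>
    have hZ := expTotal_pos prm hC gains h
    change pathWeight (A.push _) ρ.1 = _
    rw [A.pathWeight_push (rawUpdate_nonneg prm C _ _ _) _ _ ρ.2
      (pathSum_rawUpdate_ne_zero prm C _ _ _)]
    have key : ∀ σ : A.Path, pathWeight (rawUpdate prm C (weightsAfter prm C hC gains h)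
        (gains h) π) σ.1 = Real.exp (prm.η * (σ.1.map (surrTotal prm hC gains (π :: h))).sum) /
          expTotal prm hC gains h := fun σ => by
      rw [pathWeight_rawUpdate, ih, sum_map_surrTotal_cons, mul_add, Real.exp_add]
      ring
    rw [pathSum, Finset.sum_congr rfl fun σ _ => key σ, key, ← Finset.sum_div,
      div_div_div_cancel_right₀ hZ.ne']
    rfl

theorem surrTotal_nonneg (hP : IsPathPartition C) {T : ℕ} {B : ℝ} (hg : GainsBounded gains T B)
    (e : E) : ∀ h : List A.Path, h.length ≤ T → 0 ≤ surrTotal prm hC gains h e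
  | [], _ => le_rfl
  | π :: h, hT => by
    rw [List.length_cons] at hT
    exact add_nonneg (surrTotal_nonneg hP hg e h (by omega))
      (surrogateGain_nonneg prm C hC hP _ (fun e => (hg h (by omega) e).1) π e)

theorem expTotal_le [Fintype E] (hP : IsPathPartition C) {T N : ℕ} {B : ℝ} (hB0 : 0 ≤ B)
    (hg : GainsBounded gains T B) (hN : ∀ ρ : A.Path, ρ.1.length = N)
    (hη : prm.η * N * (B + prm.β) * C.card ≤ prm.γ) :
    ∀ h : List A.Path, h.length ≤ T → expTotal prm hC gains h ≤ Fintype.card A.Path *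
      Real.exp (prm.η / (1 - prm.γ) * (playedGain gains h + h.length * (prm.β * Fintype.card E) +
        prm.η * N * (B + prm.β) * ∑ e, surrTotal prm hC gains h e))
  | [], _ => by simp [expTotal, surrTotal, playedGain]
  | π :: h, hT => by
    rw [List.length_cons] at hT ⊢
    have ih := expTotal_le hP hB0 hg hN hη h (by omega)
    have h1 := sum_pathWeight_mul_exp_le prm C hC hP (weightsAfter prm C hC gains h)
      (fun e => (hg h (by omega) e).1) (fun e => (hg h (by omega) e).2) hB0 hN hη π
    have hZ := expTotal_pos prm hC gains h
    -- The ratio of consecutive potentials is the mean, under the current path weights, of the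
    -- exponential of the new surrogate gains.
    have h2 : expTotal prm hC gains (π :: h) = expTotal prm hC gains h *
        ∑ ρ : A.Path, pathWeight (weightsAfter prm C hC gains h).w ρ.1 * Real.exp (prm.η *
          (ρ.1.map (surrogateGain prm C (weightsAfter prm C hC gains h) (gains h) π)).sum) := by
      rw [expTotal, Finset.mul_sum]
      refine Finset.sum_congr rfl fun ρ _ => ?_
      rw [pathWeight_weightsAfter, sum_map_surrTotal_cons, mul_add, Real.exp_add]
      field_simp
    rw [h2]
    refine (mul_le_mul ih h1 (Finset.sum_nonneg fun ρ _ =>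
      mul_nonneg (pathWeight_nonneg (PathWeights.nonneg _) _) (Real.exp_pos _).le)
      (by positivity)).trans (le_of_eq ?_)
    rw [mul_assoc, ← Real.exp_add]
    congr 2
    simp only [playedGain, surrTotal, Finset.sum_add_distrib]
    push_cast
    ring

/-- The regret bound on the event that the surrogate gains overestimate the gains. -/
theorem regret_le_of_gainTotal_le [Fintype E] (hP : IsPathPartition C) {T N : ℕ} {B D : ℝ}
    (hB0 : 0 ≤ B) (hg : GainsBounded gains T B) (hN : ∀ ρ : A.Path, ρ.1.length = N)
    (hη : prm.η * N * (B + prm.β) * C.card ≤ prm.γ) (hγ : prm.γ ≤ 1 / 2) (hD0 : 0 ≤ D)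
    (h : List A.Path) (hT : h.length ≤ T)
    (hD : ∀ e, gainTotal gains h e ≤ surrTotal prm hC gains h e + D) (ρ : A.Path) :
    (ρ.1.map (gainTotal gains h)).sum - playedGain gains h ≤
      Real.log (Fintype.card A.Path) / prm.η + h.length * (prm.β * Fintype.card E) + N * D +
        2 * prm.γ * (N * (h.length * B)) := by
  have : Nonempty A.Path := ⟨hC.choose⟩
  have hη0 := prm.η_pos
  have hγ0 := prm.γ_pos
  have hβ := prm.β_pos
  have hγ1 : 0 < 1 - prm.γ := sub_pos.2 prm.γ_lt_one
  obtain ⟨σ, hσ⟩ := Finite.exists_max fun ρ : A.Path => (ρ.1.map (surrTotal prm hC gains h)).sum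
  set M := (σ.1.map (surrTotal prm hC gains h)).sum with hM
  have hM0 : 0 ≤ M := sum_map_nonneg (fun e => surrTotal_nonneg prm hC gains hP hg e h hT) _
  have hcard : (0 : ℝ) < Fintype.card A.Path := by exact_mod_cast Fintype.card_pos
  have hlog : 0 ≤ Real.log (Fintype.card A.Path) :=
    Real.log_nonneg (by exact_mod_cast Fintype.card_pos)
  have hsum : ∑ e, surrTotal prm hC gains h e ≤ C.card * M := by
    rw [hP.sum_eq, ← nsmul_eq_mul]
    exact Finset.sum_le_card_nsmul _ _ _ fun π _ => hσ π
  have h1 : prm.η * M ≤ Real.log (Fintype.card A.Path) + prm.η / (1 - prm.γ) *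
      (playedGain gains h + h.length * (prm.β * Fintype.card E) + prm.γ * M) := by
    rw [← Real.exp_le_exp, Real.exp_add, Real.exp_log hcard]
    have h2 : Real.exp (prm.η * M) ≤ expTotal prm hC gains h :=
      Finset.single_le_sum (f := fun ρ : A.Path =>
        Real.exp (prm.η * (ρ.1.map (surrTotal prm hC gains h)).sum))
        (fun _ _ => (Real.exp_pos _).le) (Finset.mem_univ σ)
    refine (h2.trans (expTotal_le prm hC gains hP hB0 hg hN hη h hT)).trans ?_
    -- Second use of `hη`: the second-order term shrinks to γM, which can be moved to the left-hand
    -- side.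
    have h3 : prm.η * N * (B + prm.β) * ∑ e, surrTotal prm hC gains h e ≤ prm.γ * M :=
      calc _ ≤ prm.η * N * (B + prm.β) * (C.card * M) :=
            mul_le_mul_of_nonneg_left hsum (by positivity)
        _ = prm.η * N * (B + prm.β) * C.card * M := by ring
        _ ≤ _ := mul_le_mul_of_nonneg_right hη hM0
    gcongr
  have h3 : (1 - 2 * prm.γ) * M ≤ Real.log (Fintype.card A.Path) / prm.η +
      (playedGain gains h + h.length * (prm.β * Fintype.card E)) := by
    have h4 : M ≤ Real.log (Fintype.card A.Path) / prm.η + (playedGain gains h +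
        h.length * (prm.β * Fintype.card E) + prm.γ * M) / (1 - prm.γ) := by
      rw [← mul_le_mul_iff_right₀ hη0]
      refine h1.trans (le_of_eq ?_)
      field_simp
    have h5 := mul_le_mul_of_nonneg_left h4 hγ1.le
    rw [mul_add, mul_div_cancel₀ _ hγ1.ne'] at h5
    have h6 : 0 ≤ prm.γ * (Real.log (Fintype.card A.Path) / prm.η) := by positivity
    linarith
  have hG1 : (ρ.1.map (gainTotal gains h)).sum ≤ M + N * D := by
    have e1 : (ρ.1.map (gainTotal gains h)).sum ≤
        (ρ.1.map fun e => surrTotal prm hC gains h e + D).sum :=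
      List.sum_le_sum fun e _ => hD e
    rw [List.sum_map_add] at e1
    have e2 : (ρ.1.map fun _ => D).sum = N * D := by simp [hN ρ]
    have := hσ ρ
    linarith
  have hG2 : (ρ.1.map (gainTotal gains h)).sum ≤ N * (h.length * B) := by
    have := sum_map_le (fun e => gainTotal_le hg e h hT) ρ.1
    rwa [hN ρ] at this
  have hND : 0 ≤ N * D := by positivity
  -- Split G = (1 - 2γ)G + 2γG: the first part is compared with M, the second with the trivial bound
  -- on G.
  nlinarith [mul_le_mul_of_nonneg_left hG1 (show 0 ≤ 1 - 2 * prm.γ by linarith),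
    mul_le_mul_of_nonneg_left hG2 (show 0 ≤ 2 * prm.γ by linarith), mul_nonneg hγ0.le hND]

/-! ### Concentration of the surrogate gains -/

theorem length_of_mem_support_runLaw :
    ∀ (t : ℕ) (h : List A.Path), h ∈ (runLaw prm C hC gains t).support → h.length = t
  | 0, h, hh => by simpa [runLaw] using hh
  | t + 1, h, hh => by
    simp only [runLaw, PMF.mem_support_bind_iff, PMF.mem_support_map_iff] at hh
    obtain ⟨h', hh', π, -, rfl⟩ := hh
    simp [length_of_mem_support_runLaw t h' hh']

theorem sum_mixProb_mul_exp_le (hC : C.Nonempty) (hP : IsPathPartition C) (W : A.PathWeights) (g : E → ℝ) {B : ℝ}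
    (e : E) (hg : 0 ≤ g e) (hB : g e ≤ B) (hβ : prm.β ≤ B) :
    ∑ π : A.Path, mixProb prm C W π *
      Real.exp (prm.β / B ^ 2 * (g e - surrogateGain prm C W g π e)) ≤ 1 := by
  classical
  refine le_of_eq_of_le ?_ (exp_moment_importance_weighted (flow_pos prm C hC hP W e) hg hB
    prm.β_pos hβ (flow_le_one prm C hC W e))
  set q := flow prm C W e with hq
  set x := Real.exp (prm.β / B ^ 2 * (g e - (g e + prm.β) / q))
  set y := Real.exp (prm.β / B ^ 2 * (g e - prm.β / q))
  -- The exponential takes only two values, x if the sampled path contains e and y otherwise, so its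
  -- mean is q x + (1 - q) y.
  have h1 : ∀ π : A.Path, mixProb prm C W π *
      Real.exp (prm.β / B ^ 2 * (g e - surrogateGain prm C W g π e)) =
      (if e ∈ π.1 then mixProb prm C W π else 0) * (x - y) + mixProb prm C W π * y := fun π => by
    unfold surrogateGain
    split_ifs
    · ring
    · ring
  rw [Finset.sum_congr rfl fun π _ => h1 π, Finset.sum_add_distrib, ← Finset.sum_mul,
    ← Finset.sum_mul, sum_mixProb prm C hC]
  change q * (x - y) + 1 * y = _
  ring

/-- Supermartingale argument: given the history, the next gains are fixed even for an adaptive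
adversary, and the fresh factor has conditional mean at most one. -/
theorem tsum_runLaw_mul_exp_le_one (hP : IsPathPartition C) {T : ℕ} {B : ℝ}
    (hg : GainsBounded gains T B) (hβ : prm.β ≤ B) (e : E) : ∀ t ≤ T,
    ∑' h, runLaw prm C hC gains t h * ENNReal.ofReal (Real.exp (prm.β / B ^ 2 *
      (gainTotal gains h e - surrTotal prm hC gains h e))) ≤ 1
  | 0, _ => by
    rw [runLaw, tsum_eq_single []]
    · simp [gainTotal, surrTotal]
    · intro h hh; simp [hh]
  | t + 1, ht => by
    rw [runLaw, PMF.tsum_bind_mul]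
    refine le_trans (ENNReal.tsum_le_tsum fun h => ?_)
      (tsum_runLaw_mul_exp_le_one hP hg hβ e t (by omega))
    -- Only histories of length t < T carry mass, and for these the gains are bounded.
    by_cases hh : h ∈ (runLaw prm C hC gains t).support
    swap
    · rw [PMF.mem_support_iff, not_not] at hh
      simp [hh]
    gcongr
    have hlen := length_of_mem_support_runLaw prm hC gains t h hh
    rw [PMF.tsum_map_mul, tsum_fintype]
    set W := weightsAfter prm C hC gains h with hW
    obtain ⟨hg0, hg1⟩ := hg h (by omega) e
    set c := prm.β / B ^ 2 with hc
    calc _ = ∑ π : A.Path, ENNReal.ofReal (Real.exp (c *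
            (gainTotal gains h e - surrTotal prm hC gains h e)) * (mixProb prm C W π *
            Real.exp (c * (gains h e - surrogateGain prm C W (gains h) π e)))) := by
          refine Finset.sum_congr rfl fun π _ => ?_
          rw [sampleDist, PMF.ofFintype_apply,
            ← ENNReal.ofReal_mul (mixProb_nonneg ..), mul_left_comm, ← Real.exp_add]
          congr 3
          simp only [gainTotal, surrTotal, ← hW]
          ring_nf
      _ = ENNReal.ofReal (Real.exp (c *
            (gainTotal gains h e - surrTotal prm hC gains h e)) * ∑ π : A.Path,
            (mixProb prm C W π *
            Real.exp (c * (gains h e - surrogateGain prm C W (gains h) π e)))) := by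
          rw [Finset.mul_sum, ENNReal.ofReal_sum_of_nonneg]
          intro π _
          have := mixProb_nonneg prm C W π
          positivity
      _ ≤ _ := ENNReal.ofReal_le_ofReal (mul_le_of_le_one_right (Real.exp_pos _).le
          (sum_mixProb_mul_exp_le prm hC hP W (gains h) e hg0 hg1 hβ))

/-- With high probability, the surrogate gains of all transitions overestimate their gains, up to a
deviation term. -/
theorem toOuterMeasure_gainTotal_le [Fintype E] (hP : IsPathPartition C) {T : ℕ} {B δ : ℝ}
    (hg : GainsBounded gains T B) (hβ : prm.β ≤ B) (hδ : 0 < δ) (hE : 0 < Fintype.card E) :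
    ENNReal.ofReal (1 - δ) ≤ (runLaw prm C hC gains T).toOuterMeasure
      {h | ∀ e, gainTotal gains h e ≤ surrTotal prm hC gains h e +
        B ^ 2 * Real.log (Fintype.card E / δ) / prm.β} := by
  set L := Real.log (Fintype.card E / δ) with hL
  set μ := (runLaw prm C hC gains T).toOuterMeasure with hμ
  set good := {h : List A.Path | ∀ e, gainTotal gains h e ≤ surrTotal prm hC gains h e +
        B ^ 2 * L / prm.β} with hgood
  have hE' : (0 : ℝ) < Fintype.card E := by exact_mod_cast hE
  have hB : 0 < B := prm.β_pos.trans_le hβ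
  have hβ0 := prm.β_pos
  have hexp : Real.exp (-L) = δ / Fintype.card E := by
    rw [Real.exp_neg, hL, Real.exp_log (by positivity), inv_div]
  have hbad : ∀ e, μ {h | surrTotal prm hC gains h e + B ^ 2 * L / prm.β < gainTotal gains h e} ≤
      ENNReal.ofReal (Real.exp (-L)) := fun e => by
    refine PMF.toOuterMeasure_le_of_tsum_mul_le_one _ _
      (tsum_runLaw_mul_exp_le_one prm hC gains hP hg hβ e T le_rfl) _ _ fun h hh => ?_
    rw [← ENNReal.ofReal_mul (Real.exp_pos _).le, ← Real.exp_add, ENNReal.one_le_ofReal,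
      Real.one_le_exp_iff]
    have h1 : prm.β / B ^ 2 * (B ^ 2 * L / prm.β) = L := by field_simp
    have h2 : B ^ 2 * L / prm.β ≤ gainTotal gains h e - surrTotal prm hC gains h e := by
      rw [Set.mem_ofPred_eq] at hh
      linarith
    have h3 := mul_le_mul_of_nonneg_left h2 (show 0 ≤ prm.β / B ^ 2 by positivity)
    linarith
  have hcompl : μ goodᶜ ≤ ENNReal.ofReal δ := by
    have h1 : goodᶜ = ⋃ e,
        {h | surrTotal prm hC gains h e + B ^ 2 * L / prm.β < gainTotal gains h e} := by
      ext h; simp [hgood]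
    rw [h1]
    refine (MeasureTheory.measure_iUnion_fintype_le μ _).trans
      ((Finset.sum_le_sum fun e _ => hbad e).trans (le_of_eq ?_))
    rw [Finset.sum_const, Finset.card_univ, nsmul_eq_mul, hexp,
      ← ENNReal.ofReal_natCast, ← ENNReal.ofReal_mul (by positivity)]
    congr 1
    field_simp
  have huniv : (1 : ENNReal) ≤ μ good + μ goodᶜ := by
    have : μ Set.univ = 1 :=
      (PMF.toOuterMeasure_apply_eq_one_iff _ _).2 (Set.subset_univ _)
    rw [← this, ← Set.union_compl_self good]
    exact MeasureTheory.measure_union_le _ _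
  rw [ENNReal.ofReal_sub _ hδ.le, ENNReal.ofReal_one, tsub_le_iff_right]
  exact huniv.trans (by gcongr)

end Run

end PathAutomaton

/-! ### Path counts and periodic covering paths -/

namespace Ensemble

variable {P : Ensemble}

theorem length_of_ctx_isPathToFinal : ∀ (l : List P.CtxEdge) (q : P.CtxState),
    P.ctxAutomaton.IsPathToFinal q l → ctxLayer q + l.length = P.ℓ - P.n + 1
  | [], _, h => h
  | e :: l, q, h => by
    obtain ⟨h1, h2⟩ := h
    have h3 := length_of_ctx_isPathToFinal l _ h2
    have h4 := P.ctxLayer_src e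
    rw [show ctxSrc e = q from h1] at h4
    have h5 : ctxLayer (P.ctxAutomaton.tgt e) = e.1.1 + 1 := rfl
    rw [List.length_cons]
    omega

theorem ctxPath_length (π : P.ctxAutomaton.Path) : π.1.length = P.ℓ - P.n + 1 := by
  have := length_of_ctx_isPathToFinal π.1 _ π.2
  have h : ctxLayer P.ctxAutomaton.init = 0 := rfl
  omega

theorem length_of_expert_isPathToFinal : ∀ (l : List P.Edge) (q : Fin (P.ℓ + 1)),
    P.expertAutomaton.IsPathToFinal q l → q.1 + l.length = P.ℓ
  | [], q, h => by
    have : q = Fin.last P.ℓ := h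
    simp [this]
  | e :: l, q, h => by
    obtain ⟨h1, h2⟩ := h
    have h3 := length_of_expert_isPathToFinal l _ h2
    have h4 : e.1.castSucc = q := h1
    have h5 : (P.expertAutomaton.tgt e).1 = e.1.1 + 1 := rfl
    rw [List.length_cons, ← h4, Fin.val_castSucc]
    omega

theorem expertPath_length (π : P.expertAutomaton.Path) : π.1.length = P.ℓ := by
  have := length_of_expert_isPathToFinal π.1 _ π.2
  have h : (P.expertAutomaton.init).1 = 0 := rfl
  omega

theorem getElem_fst_of_expert_isPathToFinal : ∀ (l : List P.Edge) (q : Fin (P.ℓ + 1)),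
    P.expertAutomaton.IsPathToFinal q l → ∀ (i : ℕ) (hi : i < l.length), l[i].1.1 = q.1 + i
  | [], _, _, i, hi => by simp at hi
  | e :: l, q, h, i, hi => by
    obtain ⟨h1, h2⟩ := h
    have h4 : e.1.castSucc = q := h1
    have h5 : (P.expertAutomaton.tgt e).1 = e.1.1 + 1 := rfl
    rcases i with _ | i
    · simp [← h4]
    · have := getElem_fst_of_expert_isPathToFinal l _ h2 i (by simpa using hi)
      rw [List.getElem_cons_succ, this, h5, ← h4, Fin.val_castSucc]
      omega

theorem expertPath_getElem_fst (π : P.expertAutomaton.Path) (i : ℕ) (hi : i < π.1.length) :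
    π.1[i].1.1 = i := by
  rw [getElem_fst_of_expert_isPathToFinal π.1 _ π.2 i hi]
  exact Nat.zero_add i

theorem card_expertPath_le : Fintype.card P.expertAutomaton.Path ≤ P.r ^ P.ℓ := by
  let f : P.expertAutomaton.Path → List.Vector (Fin P.r) P.ℓ :=
    fun π => ⟨π.1.map Prod.snd, by rw [List.length_map, expertPath_length]⟩
  have hf : Function.Injective f := by
    intro π ρ h
    have h1 : π.1.map Prod.snd = ρ.1.map Prod.snd := congrArg Subtype.val h
    refine Subtype.ext (List.ext_getElem (by rw [expertPath_length, expertPath_length]) ?_)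
    intro i hi hi'
    refine Prod.ext (Fin.ext ?_) ?_
    · rw [expertPath_getElem_fst, expertPath_getElem_fst]
    · have h2 := List.getElem_of_eq h1 (by simpa using hi)
      rwa [List.getElem_map, List.getElem_map] at h2
  simpa using Fintype.card_le_of_injective f hf

theorem gram_injective : Function.Injective (gram : P.CtxEdge → List P.Edge) := by
  intro e e' h
  have h1 := congrFun (List.ofFn_injective h)
  have hn := P.one_le_n
  refine Prod.ext (Fin.ext ?_) (funext fun k => (Prod.ext_iff.1 (h1 k)).2)
  have := congrArg Fin.val (Prod.ext_iff.1 (h1 ⟨0, hn⟩)).1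
  simpa using this

theorem rewrites_unrewrite (π' : P.ctxAutomaton.Path) : Rewrites (unrewrite π') π' :=
  (exists_unrewrite π').choose_spec

theorem unrewrite_injective :
    Function.Injective (unrewrite : P.ctxAutomaton.Path → P.expertAutomaton.Path) := by
  intro π ρ h
  have h1 := rewrites_unrewrite π
  rw [h] at h1
  exact Subtype.ext (List.map_injective_iff.2 gram_injective
    (h1.symm.trans (rewrites_unrewrite ρ)))

theorem card_ctxPath_le : Fintype.card P.ctxAutomaton.Path ≤ P.r ^ P.ℓ :=
  (Fintype.card_le_of_injective _ unrewrite_injective).trans card_expertPath_le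

/-- The state of the context-dependent automaton in layer `i` on the path of the word `x`. -/
def wordState (x : ℕ → Fin P.r) (i : ℕ) (hi : i ≤ P.ℓ - P.n + 1) : P.CtxState :=
  if h : i = 0 then .start else .mem ⟨i - 1, by omega⟩ fun k => x (i + k.1)

/-- The transition from layer `i` to layer `i + 1` on the path of the word `x`. -/
def wordEdge (x : ℕ → Fin P.r) (i : Fin (P.ℓ - P.n + 1)) : P.CtxEdge := (i, fun k => x (i.1 + k.1))

theorem wordEdges_isPath (x : ℕ → Fin P.r) (i m : ℕ) (hm : i + m = P.ℓ - P.n + 1) :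
    P.ctxAutomaton.IsPathToFinal (wordState x i (by omega))
      (List.ofFn fun k : Fin m => wordEdge x ⟨i + k.1, by omega⟩) := by
  induction m generalizing i with
  | zero =>
    rw [List.ofFn_zero]
    change ctxLayer _ = _
    unfold wordState
    rw [dif_neg (by omega)]
    simp only [ctxLayer]
    omega
  | succ m ih =>
    rw [List.ofFn_succ]
    refine ⟨?_, ?_⟩
    · change ctxSrc _ = _
      unfold ctxSrc wordState wordEdge
      simp only [Fin.val_zero, add_zero]
      split_ifs
      · rfl
      · rfl
    · have := ih (i + 1) (by omega)
      convert this using 1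
      · change ctxTgt _ = _
        unfold ctxTgt wordState wordEdge
        rw [dif_neg (by omega)]
        simp only [Fin.val_zero, add_zero, Nat.add_sub_cancel]
        congr 1
        funext k
        simp only [lasts]
        congr 1
        omega
      · congr 1
        funext k
        congr 2
        simp only [Fin.val_succ]
        omega

/-- The accepting path of the context-dependent automaton that reads the word `x`. -/
def wordPath (x : ℕ → Fin P.r) : P.ctxAutomaton.Path :=
  ⟨List.ofFn (wordEdge x), by
    have := wordEdges_isPath x 0 (P.ℓ - P.n + 1) (Nat.zero_add _)
    simp only [Nat.zero_add] at this
    exact this⟩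

theorem mem_wordPath (x : ℕ → Fin P.r) (e : P.CtxEdge) :
    e ∈ (wordPath x).1 ↔ ∀ k : Fin P.n, e.2 k = x (e.1.1 + k.1) := by
  simp only [wordPath, List.mem_ofFn', Set.mem_range, wordEdge]
  constructor
  · rintro ⟨i, rfl⟩ k; rfl
  · intro h; exact ⟨e.1, Prod.ext rfl (funext fun k => (h k).symm)⟩

theorem exists_rewrites (π : P.expertAutomaton.Path) : ∃ π', Rewrites π π' := by
  have hlen := expertPath_length π
  have hn := P.n_le_ℓ
  -- Letters beyond the end of π are never read; the default only makes the word infinite.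
  let x : ℕ → Fin P.r := fun i =>
    if h : i < π.1.length then π.1[i].2 else ⟨0, P.one_le_r⟩
  refine ⟨wordPath x, ?_⟩
  unfold Rewrites windows wordPath
  refine List.ext_getElem ?_ ?_
  · simp [hlen]; omega
  · intro i hi hi'
    have hi2 : i < P.ℓ - P.n + 1 := by simpa using hi'
    simp only [List.getElem_map, List.getElem_range, List.getElem_ofFn, gram, wordEdge]
    refine List.ext_getElem ?_ ?_
    · simp [hlen]; omega
    · intro k hk hk'
      have hk2 : k < P.n := by simpa using hk'
      rw [List.getElem_take, List.getElem_drop, List.getElem_ofFn]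
      refine Prod.ext (Fin.ext ?_) ?_
      · rw [expertPath_getElem_fst]
      · simp only [x]
        rw [dif_pos (by omega)]

/-- The periodic word with period `w`. -/
def periodicWord (w : Fin P.n → Fin P.r) (i : ℕ) : Fin P.r :=
  w ⟨i % P.n, Nat.mod_lt _ P.one_le_n⟩

/-- The n consecutive positions of an `n`-gram meet every residue class mod n once, so its letters
are a cyclic shift of the period. -/
theorem existsUnique_mem_wordPath_periodicWord (e : P.CtxEdge) :
    ∃! w : Fin P.n → Fin P.r, e ∈ (wordPath (periodicWord w)).1 := by
  have hn : 0 < P.n := P.one_le_n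
  have hshift : Function.Bijective (fun k : Fin P.n =>
      (⟨(e.1.1 + k.1) % P.n, Nat.mod_lt _ hn⟩ : Fin P.n)) := by
    refine Finite.injective_iff_bijective.1 fun a b h => Fin.ext ?_
    have h1 : e.1.1 + a.1 ≡ e.1.1 + b.1 [MOD P.n] := congrArg Fin.val h
    exact Nat.ModEq.eq_of_lt_of_lt (Nat.ModEq.add_left_cancel' _ h1) a.2 b.2
  let f := Equiv.ofBijective _ hshift
  have key : ∀ w : Fin P.n → Fin P.r, e ∈ (wordPath (periodicWord w)).1 ↔ w = e.2 ∘ f.symm := by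
    intro w
    rw [mem_wordPath]
    constructor
    · intro h
      funext k
      have := h (f.symm k)
      have h2 : f (f.symm k) = k := f.apply_symm_apply k
      rw [Function.comp_apply, this]
      exact (congrArg w h2).symm
    · rintro rfl k
      change e.2 k = e.2 (f.symm (f k))
      rw [f.symm_apply_apply]
  exact ⟨_, (key _).2 rfl, fun w hw => (key w).1 hw⟩

theorem exists_pathPartition : ∃ C : Finset P.ctxAutomaton.Path,
    PathAutomaton.IsPathPartition C ∧ C.card = P.r ^ P.n ∧
      ∀ π ∈ C, π.1.length = P.ℓ - P.n + 1 := by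
  classical
  let F : (Fin P.n → Fin P.r) → P.ctxAutomaton.Path := fun w => wordPath (periodicWord w)
  -- The first transition spells out the period, so different periods give different paths and `C`
  -- has exactly `r ^ n` elements.
  have hmem : ∀ w : Fin P.n → Fin P.r, ((0, w) : P.CtxEdge) ∈ (F w).1 := fun w => by
    rw [mem_wordPath]
    intro k
    simp [periodicWord, Nat.mod_eq_of_lt k.2]
  have hF : Function.Injective F := fun w v h =>
    (existsUnique_mem_wordPath_periodicWord (0, w)).unique (hmem w)
      (show _ ∈ (F v).1 from h ▸ hmem w)
  refine ⟨Finset.univ.image F, fun e => ?_, ?_, fun π _ => ctxPath_length π⟩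
  · obtain ⟨w, hw, hu⟩ := existsUnique_mem_wordPath_periodicWord e
    refine ⟨F w, ⟨Finset.mem_image_of_mem _ (Finset.mem_univ _), hw⟩, ?_⟩
    rintro π ⟨hπ, he⟩
    obtain ⟨v, -, rfl⟩ := Finset.mem_image.1 hπ
    rw [hu v he]
  · rw [Finset.card_image_of_injective _ hF]
    simp

/-! ### Additivity of the gains and trivial regret bounds -/

section Gains

variable {α : Type*} [DecidableEq α]

theorem windows_map {β γ : Type*} (n : ℕ) (f : β → γ) (l : List β) :
    windows n (l.map f) = (windows n l).map (List.map f) := by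
  simp [windows, List.map_drop, List.map_take, Function.comp_def]

theorem transitionGain_nonneg (Θ : Finset (List α)) (ρ : P.Round α) (e : P.CtxEdge) :
    0 ≤ transitionGain Θ ρ e := by
  unfold transitionGain
  split_ifs <;> positivity

/-- Double counting: summing over patterns their numbers of occurrences is summing over the windows
of x those that are patterns. -/
theorem countGain_eq {n : ℕ} {Θ : Finset (List α)} (hΘ : ∀ θ ∈ Θ, θ.length = n) (x y : List α) :
    countGain Θ x y =
      ((windows n x).map fun v => if v ∈ Θ then (occurrences v y : ℝ) else 0).sum := by
  have h1 : countGain Θ x y =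
      ∑ θ ∈ Θ, ((windows n x).count θ : ℝ) * (occurrences θ y : ℝ) :=
    Finset.sum_congr rfl fun θ hθ => by rw [occurrences, hΘ θ hθ]
  rw [h1]
  induction windows n x with
  | nil => simp
  | cons v l ih =>
    rw [List.map_cons, List.sum_cons, ← ih]
    simp only [List.count_cons, beq_iff_eq]
    push_cast
    simp [add_mul, Finset.sum_add_distrib, add_comm]

theorem pathGain_eq {Θ : Finset (List α)} (hΘ : ∀ θ ∈ Θ, θ.length = P.n) (ρ : P.Round α)
    {π : P.expertAutomaton.Path} {π' : P.ctxAutomaton.Path} (h : Rewrites π π') :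
    pathGain Θ ρ π = (π'.1.map (transitionGain Θ ρ)).sum := by
  unfold pathGain
  rw [countGain_eq hΘ, windows_map, show windows P.n π.1 = π'.1.map gram from h, List.map_map,
    List.map_map]
  rfl

theorem regret_eq {Θ : Finset (List α)} (hΘ : ∀ θ ∈ Θ, θ.length = P.n) (adv : P.Adversary α)
    {π : P.expertAutomaton.Path} {π' : P.ctxAutomaton.Path} (hπ : Rewrites π π') :
    ∀ h : List P.ctxAutomaton.Path, regret Θ adv π h =
      (π'.1.map (PathAutomaton.gainTotal (fun h => transitionGain Θ (adv h)) h)).sum -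
        PathAutomaton.playedGain (fun h => transitionGain Θ (adv h)) h
  | [] => by simp [regret, PathAutomaton.gainTotal, PathAutomaton.playedGain]
  | σ :: h => by
    have e : (π'.1.map (PathAutomaton.gainTotal (fun h => transitionGain Θ (adv h)) (σ :: h))).sum
        = (π'.1.map (PathAutomaton.gainTotal (fun h => transitionGain Θ (adv h)) h)).sum +
          (π'.1.map (transitionGain Θ (adv h))).sum := by
      rw [← List.sum_map_add]; rfl
    rw [e, regret, regret_eq hΘ adv hπ h, PathAutomaton.playedGain, pathGain_eq hΘ (adv h) hπ,
      pathGain_eq hΘ (adv h) (rewrites_unrewrite σ)]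
    ring

theorem regret_le_trivial {Θ : Finset (List α)} (hΘ : ∀ θ ∈ Θ, θ.length = P.n)
    (adv : P.Adversary α) {T : ℕ} {B : ℝ} (hg : PathAutomaton.GainsBounded
      (fun h => transitionGain Θ (adv h)) T B) (π : P.expertAutomaton.Path)
    (h : List P.ctxAutomaton.Path) (hT : h.length ≤ T) :
    regret Θ adv π h ≤ ((P.ℓ - P.n + 1 : ℕ) : ℝ) * (h.length * B) := by
  obtain ⟨π', hπ⟩ := exists_rewrites π
  rw [regret_eq hΘ adv hπ]
  have h1 := PathAutomaton.sum_map_le (fun e => PathAutomaton.gainTotal_le hg e h hT) π'.1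
  rw [ctxPath_length] at h1
  have h2 : 0 ≤ PathAutomaton.playedGain (fun h => transitionGain Θ (adv h)) h := by
    clear h1 hT
    induction h with
    | nil => exact le_rfl
    | cons σ h ih =>
      exact add_nonneg ih (PathAutomaton.sum_map_nonneg (transitionGain_nonneg Θ _) _)
  linarith

theorem regret_eq_zero (hr : P.r = 1) (Θ : Finset (List α)) (adv : P.Adversary α)
    (π : P.expertAutomaton.Path) : ∀ h : List P.ctxAutomaton.Path, regret Θ adv π h = 0
  | [] => rfl
  | σ :: h => by
    have h1 : Fintype.card P.expertAutomaton.Path ≤ 1 := by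
      simpa [hr] using card_expertPath_le (P := P)
    have := Fintype.card_le_one_iff.1 h1 π (unrewrite σ)
    rw [regret, regret_eq_zero hr Θ adv π h, this]
    simp

theorem ofReal_le_toOuterMeasure_of_forall {β : Type*} (p : PMF β) {δ : ℝ} (hδ : 0 < δ)
    {s : Set β} (hs : ∀ b ∈ p.support, b ∈ s) :
    ENNReal.ofReal (1 - δ) ≤ p.toOuterMeasure s := by
  rw [(PMF.toOuterMeasure_apply_eq_one_iff p _).2 hs, ← ENNReal.ofReal_one]
  exact ENNReal.ofReal_le_ofReal (by linarith)

end Gains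

end Ensemble

/-! ### Choice of the parameters -/

namespace Ensemble

variable {P : Ensemble}

/-- The high-probability regret bound for parameters that are expressed through the square roots
`s, u, k, v` of the number of rounds, of a bound on the log-number of paths, of the number of
covering paths and of the log-confidence. -/
theorem regret_bound_of_params (prm : PathAutomaton.CDSBParams) {T : ℕ} {B δ s u k v : ℝ}
    (hB : 0 < B) (hδ : 0 < δ) (hu : 0 < u) (hk : 1 ≤ k) (hv : 0 < v)
    (hs : 2 * (2 * k * u + k * v) < s) (hs2 : s ^ 2 = T) (hk2 : k ^ 2 = (P.r : ℝ) ^ P.n)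
    (hu2 : u ^ 2 = P.ℓ * Real.log P.r)
    (hv2 : v ^ 2 = Real.log ((P.r : ℝ) ^ P.n * ((P.ℓ - P.n + 1 : ℕ) : ℝ) / δ))
    (hη : prm.η = u / (2 * s * ((P.ℓ - P.n + 1 : ℕ) : ℝ) * k * B))
    (hβ : prm.β = B * v / (s * k)) (hγ : prm.γ = u * k / s)
    {C : Finset P.ctxAutomaton.Path} (hC : C.Nonempty) (hP : PathAutomaton.IsPathPartition C)
    (hcard : C.card = P.r ^ P.n) {α : Type*} [DecidableEq α] {Θ : Finset (List α)}
    (hΘ : ∀ θ ∈ Θ, θ.length = P.n) (adv : P.Adversary α)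
    (hg : PathAutomaton.GainsBounded (fun h => transitionGain Θ (adv h)) T B) :
    ENNReal.ofReal (1 - δ) ≤ (cdsbLaw prm C hC Θ adv T).toOuterMeasure
      {h | ∀ πs : P.expertAutomaton.Path, regret Θ adv πs h ≤
        2 * B * ((P.ℓ - P.n + 1 : ℕ) : ℝ) * s * (2 * k * u + k * v)} := by
  set N : ℕ := P.ℓ - P.n + 1 with hN
  have hN0 : (0 : ℝ) < N := by rw [hN]; positivity
  have hk0 : 0 < k := by linarith
  have hku : 0 < k * u := by positivity
  have hkv : 0 < k * v := by positivity
  have hs0 : 0 < s := by nlinarith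
  have hE : (Fintype.card P.CtxEdge : ℝ) = k ^ 2 * N := by
    rw [hk2]; simp [hN, mul_comm]
  have hE0 : 0 < Fintype.card P.CtxEdge := by
    have : (0 : ℝ) < Fintype.card P.CtxEdge := by rw [hE]; positivity
    exact_mod_cast this
  have hC2 : (C.card : ℝ) = k ^ 2 := by rw [hk2, hcard]; push_cast; rfl
  have hβB : prm.β ≤ B := by
    rw [hβ, div_le_iff₀ (by positivity)]
    have : v ≤ s * k := by nlinarith
    nlinarith
  have hγ2 : prm.γ ≤ 1 / 2 := by
    rw [hγ, div_le_iff₀ hs0]; nlinarith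
  -- The formula for η is the one that gives equality when β is replaced by its upper bound B.
  have hηγ : prm.η * N * (B + prm.β) * C.card ≤ prm.γ := by
    calc _ ≤ prm.η * N * (B + B) * C.card := by have := prm.η_pos; gcongr
      _ = prm.γ := by rw [hη, hγ, hC2]; field_simp; ring
  have hlog : Real.log (Fintype.card P.ctxAutomaton.Path) ≤ u ^ 2 := by
    have : Nonempty P.ctxAutomaton.Path := ⟨hC.choose⟩
    rw [hu2, ← Real.log_pow]
    refine Real.log_le_log (by exact_mod_cast Fintype.card_pos) ?_
    exact_mod_cast card_ctxPath_le
  have hgood := PathAutomaton.toOuterMeasure_gainTotal_le prm hC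
    (fun h => transitionGain Θ (adv h)) hP hg hβB hδ hE0
  refine hgood.trans (PMF.toOuterMeasure_mono _ ?_)
  -- The inclusion of events is needed only on the support, where the history has length T.
  rintro h ⟨hh, hsupp⟩ πs
  have hT := PathAutomaton.length_of_mem_support_runLaw prm hC _ T h hsupp
  obtain ⟨π', hπ⟩ := exists_rewrites πs
  rw [regret_eq hΘ adv hπ]
  rw [Set.mem_ofPred_eq, hE, hk2, ← hv2] at hh
  have hβ0 := prm.β_pos
  have hη0 := prm.η_pos
  refine (PathAutomaton.regret_le_of_gainTotal_le prm hC _ hP hB.le hg ctxPath_length hηγ hγ2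
    (by positivity) h hT.le hh π').trans ?_
  -- In units of B N s k the four terms are 2u, v, v and 2u: η and γ balance the u-terms, β the
  -- v-terms.
  calc _ ≤ u ^ 2 / prm.η + s ^ 2 * (prm.β * (k ^ 2 * N)) + N * (B ^ 2 * v ^ 2 / prm.β) +
        2 * prm.γ * (N * (s ^ 2 * B)) := by
        rw [hE, hs2, hT]
        gcongr
    _ = _ := by
        rw [hη, hβ, hγ]
        field_simp
        ring

end Ensemble

theorem mainTheorem8 (P : Ensemble) :
    (∃ C : Finset P.ctxAutomaton.Path,
      PathAutomaton.IsPathPartition C ∧ C.card = P.r ^ P.n ∧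
        ∀ π ∈ C, π.1.length = P.ℓ - P.n + 1) ∧
    ∀ (T : ℕ) (B δ : ℝ), 0 < δ → δ < 1 →
      ∃ prm : PathAutomaton.CDSBParams,
        ∀ (C : Finset P.ctxAutomaton.Path) (hC : C.Nonempty),
          PathAutomaton.IsPathPartition C → C.card = P.r ^ P.n →
        ∀ (Alph : Type*) [DecidableEq Alph] (Θ : Finset (List Alph)),
          (∀ θ ∈ Θ, θ.length = P.n) →
        ∀ adv : P.Adversary Alph,
          (∀ h : List P.ctxAutomaton.Path, h.length < T →
            ∀ e, Ensemble.transitionGain Θ (adv h) e ≤ B) →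
          ENNReal.ofReal (1 - δ) ≤
            (Ensemble.cdsbLaw prm C hC Θ adv T).toOuterMeasure
              {h | ∀ πs : P.expertAutomaton.Path,
                Ensemble.regret Θ adv πs h ≤
                  2 * B * ((P.ℓ : ℝ) - P.n + 1) * √(T : ℝ) *
                    (√(4 * (P.r : ℝ) ^ P.n * P.ℓ * Real.log P.r) +
                      √((P.r : ℝ) ^ P.n *
                        Real.log ((P.r : ℝ) ^ P.n * ((P.ℓ : ℝ) - P.n + 1) / δ)))} := by
  refine ⟨Ensemble.exists_pathPartition, fun T B δ hδ hδ1 => ?_⟩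
  have hNcast : (P.ℓ : ℝ) - P.n + 1 = ((P.ℓ - P.n + 1 : ℕ) : ℝ) := by
    rw [Nat.cast_add, Nat.cast_sub P.n_le_ℓ, Nat.cast_one]
  rw [hNcast]
  set N : ℕ := P.ℓ - P.n + 1 with hN
  have hN1 : (1 : ℝ) ≤ N := by exact_mod_cast Nat.le_add_left 1 _
  have hr1 : (1 : ℝ) ≤ P.r := by exact_mod_cast P.one_le_r
  have hK1 : (1 : ℝ) ≤ (P.r : ℝ) ^ P.n := one_le_pow₀ hr1
  have hL : 0 < Real.log ((P.r : ℝ) ^ P.n * N / δ) := by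
    refine Real.log_pos ?_
    rw [lt_div_iff₀ hδ]
    nlinarith
  have e1 : √(4 * (P.r : ℝ) ^ P.n * P.ℓ * Real.log P.r) =
      2 * √((P.r : ℝ) ^ P.n) * √(P.ℓ * Real.log P.r) := by
    rw [mul_assoc, Real.sqrt_mul (by positivity), Real.sqrt_mul (by positivity)]
    congr 2
    rw [show (4 : ℝ) = 2 ^ 2 by norm_num]
    exact Real.sqrt_sq (by norm_num)
  have e2 : √((P.r : ℝ) ^ P.n * Real.log ((P.r : ℝ) ^ P.n * N / δ)) =
      √((P.r : ℝ) ^ P.n) * √(Real.log ((P.r : ℝ) ^ P.n * N / δ)) :=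
    Real.sqrt_mul (by positivity) _
  rw [e1, e2]
  set k := √((P.r : ℝ) ^ P.n) with hk
  set u := √(P.ℓ * Real.log P.r) with hu
  set v := √(Real.log ((P.r : ℝ) ^ P.n * N / δ)) with hv
  set s := √(T : ℝ) with hs
  have hk1 : 1 ≤ k := Real.one_le_sqrt.2 hK1
  have hv0 : 0 < v := Real.sqrt_pos.2 hL
  have hu0 : 0 ≤ u := Real.sqrt_nonneg _
  have hs0 : 0 ≤ s := Real.sqrt_nonneg _
  have hs2 : s ^ 2 = T := Real.sq_sqrt (Nat.cast_nonneg T)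
  -- r ≠ 1 keeps u, and with it η and γ, positive; the lower bound on s yields γ ≤ 1/2 and β ≤ B.
  by_cases hmain : 0 < B ∧ P.r ≠ 1 ∧ 2 * (2 * k * u + k * v) < s
  · obtain ⟨hB, hr, hsl⟩ := hmain
    have hu0 : 0 < u := by
      have h1 : (1 : ℝ) < P.r := by
        exact_mod_cast lt_of_le_of_ne P.one_le_r (Ne.symm hr)
      have h2 : (0 : ℝ) < P.ℓ := by exact_mod_cast P.one_le_n.trans P.n_le_ℓ
      exact Real.sqrt_pos.2 (mul_pos h2 (Real.log_pos h1))
    have hk0 : 0 < k := by linarith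
    have hku : 0 < k * u := by positivity
    have hkv : 0 < k * v := by positivity
    have hs0 : 0 < s := by nlinarith
    refine ⟨⟨u / (2 * s * N * k * B), B * v / (s * k), u * k / s, by positivity, by positivity,
      by positivity, by rw [div_lt_one hs0]; nlinarith⟩, fun C hC hP hcard Alph _ Θ hΘ adv hg => ?_⟩
    exact Ensemble.regret_bound_of_params _ hB hδ hu0 hk1 hv0 hsl hs2
      (Real.sq_sqrt (by positivity)) (Real.sq_sqrt (by positivity)) (Real.sq_sqrt hL.le)
      rfl rfl rfl hC hP hcard hΘ adv
      fun h hh e => ⟨Ensemble.transitionGain_nonneg _ _ _, hg h hh e⟩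
  -- Here any parameters do: the bound holds on every history in the support, because T = 0, r = 1
  -- (a single expert), B = 0, or s is so small that the trivial bound N T B suffices.
  · refine ⟨⟨1, 1, 1 / 2, one_pos, one_pos, by norm_num, by norm_num⟩,
      fun C hC hP hcard Alph _ Θ hΘ adv hg => ?_⟩
    have hg' : PathAutomaton.GainsBounded (fun h => Ensemble.transitionGain Θ (adv h)) T B :=
      fun h hh e => ⟨Ensemble.transitionGain_nonneg _ _ _, hg h hh e⟩
    refine Ensemble.ofReal_le_toOuterMeasure_of_forall _ hδ fun h hh πs => ?_
    have hlen := PathAutomaton.length_of_mem_support_runLaw _ hC _ T h hh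
    have htriv := Ensemble.regret_le_trivial hΘ adv hg' πs h hlen.le
    rw [← hN, hlen, ← hs2] at htriv
    have hkuv : 0 ≤ 2 * k * u + k * v := by positivity
    rcases Nat.eq_zero_or_pos T with hT | hT
    · have : s = 0 := by rw [hs, hT]; simp
      rw [this] at htriv ⊢
      simpa using htriv
    -- A first round exists and its gains lie between 0 and B, which rules out negative B.
    have hB0 : 0 ≤ B := by
      obtain ⟨h0, h1⟩ := hg' [] hT (0, fun _ => ⟨0, P.one_le_r⟩)
      exact h0.trans h1
    by_cases hr : P.r = 1
    · rw [Ensemble.regret_eq_zero hr]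
      positivity
    rcases hB0.eq_or_lt with hB | hB
    · rw [← hB] at htriv ⊢
      simpa using htriv
    have hsl : s ≤ 2 * (2 * k * u + k * v) := by
      by_contra hlt
      exact hmain ⟨hB, hr, not_le.1 hlt⟩
    refine htriv.trans ?_
    calc (N : ℝ) * (s ^ 2 * B) = N * s * B * s := by ring
      _ ≤ N * s * B * (2 * (2 * k * u + k * v)) := by gcongr
      _ = _ := by ring
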